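/- Let $A\in\mathbb R^{n\times n}$, $B\in\mathbb R^{n\times p}$, $C\in\mathbb R^{m\times n}$, $D\in\mathbb R^{m\times p}$ be such that $(A,B,C,D)$ is minimal, that is, controllable and observable: $$\operatorname{rank}[\,B\mid AB\mid\cdots\mid A^{n-1}B\,]=n,\qquad \operatorname{rank}[\,C;\,CA;\,\dots;\,CA^{n-1}\,]=n .$$ Consider the linear system $x_{t+1}=Ax_t+Bu_t+B_ww_t$, $y_t=Cx_t+Du_t+D_zz_t$ $(t\ge 1)$, started at a deterministic state $x_1\in\mathbb R^n$, with process and sensor noise identically zero ($w_t=0$, $z_t=0$) and i.i.d. inputs $u_t\sim\mathcal N(0,I_p)$. For $T\ge1$ put $$\bar u_t=[u_t\mid u_{t-1}\mid\cdots\mid u_{t-T+1}]\in\mathbb R^{Tp},\qquad G_\star=[D\mid CB\mid CAB\mid\cdots\mid CA^{T-2}B]\in\mathbb R^{m\times Tp},$$ and for $T\le N_1\le N/10$ let $$\widehat G_{\mathrm{LS}}\in\operatorname*{arg\,min}_{G\in\mathbb R^{m\times Tp}}\ \sum_{t=N_1}^{N}\|G\bar u_t-y_t\|_2^2$$ be any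 ordinary least squares estimate. 1. (Lower bound.) There is a universal constant $c>0$ such that the following holds. If a Jordan decomposition of $A$ over $\mathbb C$ has a block of size $k$ with eigenvalue $\lambda$, $|\lambda|=1$, then there is a constant $\mathsf C>0$ that depends only on $A,B,C$ (with their dimensions) and $k$ such that, for every $D,B_w,D_z,x_1$ and every $T\ge1$, there is an $N_0$ such that for all $N\ge N_0$ and all $N_1$ with $T\le N_1\le N/10$, $$\Pr\left[\ \|\widehat G_{\mathrm{LS}}-G_\star\|_{\mathrm{op}}\ \ge\ \mathsf C\,N^{k-1}\ \right]\ \ge\ c .$$ 2. (Inconsistency.) If $A$ has spectral radius $\rho(A)=1$ (a marginally stable system), then for every $T\ge1$ and every choice of $N_1=N_1(N)$ with $T\le N_1(N)\le N/10$ for all large $N$, the ordinary least squares estimates $\widehat G_{\mathrm{LS}}=\widehat G_{\mathrm{LS}}(N)$ do not converge to $G_\star$ in probability as $N\to\infty$. -/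

import Mathlib

open MeasureTheory ProbabilityTheory Filter Topology
open scoped Matrix Matrix.Norms.L2Operator

noncomputable section

namespace OLSLowerBound

/-- The `k × k` upper triangular Jordan block with eigenvalue `ev`. -/
def jordanBlock (ev : ℂ) (k : ℕ) : Matrix (Fin k) (Fin k) ℂ :=
  Matrix.of fun i j => if i = j then ev else if i.val + 1 = j.val then 1 else 0

/-- A Jordan decomposition `A = S J S⁻¹` over `ℂ` of the real matrix `A` contains a block of size
`k` with eigenvalue `ev`. -/
def HasJordanBlock {n : ℕ} (A : Matrix (Fin n) (Fin n) ℝ) (ev : ℂ) (k : ℕ) : Prop :=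
  ∃ (r : ℕ) (size : Fin r → ℕ) (eig : Fin r → ℂ) (e : (Σ i, Fin (size i)) ≃ Fin n)
    (S : Matrix (Fin n) (Fin n) ℂ),
    (∀ i, 1 ≤ size i) ∧ IsUnit S ∧
    A.map (fun a : ℝ => (a : ℂ)) =
      S * Matrix.reindex e e (Matrix.blockDiagonal' fun i => jordanBlock (eig i) (size i)) * S⁻¹ ∧
    ∃ i, eig i = ev ∧ size i = k

/-- The controllability matrix `[B | A B | ⋯ | A^(n-1) B]`. -/
def controllabilityMatrix {n p : ℕ} (A : Matrix (Fin n) (Fin n) ℝ) (B : Matrix (Fin n) (Fin p) ℝ) :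
    Matrix (Fin n) (Fin n × Fin p) ℝ :=
  Matrix.of fun i jl => (A ^ (jl.1 : ℕ) * B) i jl.2

/-- The observability matrix, with block rows `C`, `C A`, …, `C A^(n-1)`. -/
def observabilityMatrix {n m : ℕ} (A : Matrix (Fin n) (Fin n) ℝ) (C : Matrix (Fin m) (Fin n) ℝ) :
    Matrix (Fin n × Fin m) (Fin n) ℝ :=
  Matrix.of fun jl i => (C * A ^ (jl.1 : ℕ)) jl.2 i

/-- Minimality of `(A, B, C, D)`: controllable and observable (`D` plays no role). -/
def IsMinimal {n m p : ℕ} (A : Matrix (Fin n) (Fin n) ℝ) (B : Matrix (Fin n) (Fin p) ℝ)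
    (C : Matrix (Fin m) (Fin n) ℝ) : Prop :=
  (controllabilityMatrix A B).rank = n ∧ (observabilityMatrix A C).rank = n

/-- The sequences (indexed by times `t ≥ 1`) obey the dynamics
`x_{t+1} = A x_t + B u_t + B_w w_t`, `y_t = C x_t + D u_t + D_z z_t` from the initial state `xinit`. -/
structure IsTrajectory {n m p dw dz : ℕ} (A : Matrix (Fin n) (Fin n) ℝ)
    (B : Matrix (Fin n) (Fin p) ℝ) (C : Matrix (Fin m) (Fin n) ℝ) (D : Matrix (Fin m) (Fin p) ℝ)
    (Bw : Matrix (Fin n) (Fin dw) ℝ) (Dz : Matrix (Fin m) (Fin dz) ℝ) (xinit : Fin n → ℝ)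
    (u : ℕ → Fin p → ℝ) (w : ℕ → Fin dw → ℝ) (z : ℕ → Fin dz → ℝ)
    (x : ℕ → Fin n → ℝ) (y : ℕ → Fin m → ℝ) : Prop where
  init : x 1 = xinit
  state : ∀ t, 1 ≤ t → x (t + 1) = A *ᵥ x t + B *ᵥ u t + Bw *ᵥ w t
  output : ∀ t, 1 ≤ t → y t = C *ᵥ x t + D *ᵥ u t + Dz *ᵥ z t

/-- The random inputs `u_1, u_2, …` are independent standard Gaussian vectors, `u_t ∼ N(0, I_p)`. -/
structure IsGaussianInput {p : ℕ} {Ω : Type*} [MeasurableSpace Ω] (μ : Measure Ω)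
    (u : ℕ → Ω → Fin p → ℝ) : Prop where
  indep : iIndepFun (fun t : ℕ => u (t + 1)) μ
  law : ∀ t, 1 ≤ t → HasLaw (u t) (Measure.pi fun _ : Fin p => gaussianReal 0 1) μ

/-- The length-`T` response `[D | C B | C A B | ⋯ | C A^(T-2) B]`. -/
def response {n m p : ℕ} (A : Matrix (Fin n) (Fin n) ℝ) (B : Matrix (Fin n) (Fin p) ℝ)
    (C : Matrix (Fin m) (Fin n) ℝ) (D : Matrix (Fin m) (Fin p) ℝ) (T : ℕ) :
    Matrix (Fin m) (Fin T × Fin p) ℝ :=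
  Matrix.of fun i jl =>
    if (jl.1 : ℕ) = 0 then D i jl.2 else (C * A ^ ((jl.1 : ℕ) - 1) * B) i jl.2

/-- The concatenated input `[u_t | u_{t-1} | ⋯ | u_{t-T+1}]` (used for `t ≥ T` only). -/
def concatInput {p : ℕ} (T : ℕ) (u : ℕ → Fin p → ℝ) (t : ℕ) : Fin T × Fin p → ℝ :=
  fun jl => u (t - (jl.1 : ℕ)) jl.2

/-- The sum of squared Euclidean residuals over the times `N₁, …, N`. -/
def squaredLoss {m p : ℕ} (T N₁ N : ℕ) (u : ℕ → Fin p → ℝ) (y : ℕ → Fin m → ℝ)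
    (G : Matrix (Fin m) (Fin T × Fin p) ℝ) : ℝ :=
  ∑ t ∈ Finset.Icc N₁ N, ‖WithLp.toLp 2 (G *ᵥ concatInput T u t - y t)‖ ^ 2

/-- `G` is an ordinary least squares estimate, i.e. a minimizer of the squared loss. -/
def IsOLS {m p : ℕ} (T N₁ N : ℕ) (u : ℕ → Fin p → ℝ) (y : ℕ → Fin m → ℝ)
    (G : Matrix (Fin m) (Fin T × Fin p) ℝ) : Prop :=
  ∀ G' : Matrix (Fin m) (Fin T × Fin p) ℝ, squaredLoss T N₁ N u y G ≤ squaredLoss T N₁ N u y G'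

end OLSLowerBound

end

/-! The noise is zero, but the least squares model sees only the last `T` inputs, so the part of
`y_t` driven by older inputs and by the initial state acts as noise. Its size is governed by the
Markov parameters `C A^r B`. A Jordan block of size `d + 1` on the unit circle makes a bilinear form
of `A^r` grow like `r.choose d`, and minimality passes this growth on to the Markov parameters
(`exists_choose_sq_le`). Summed over the sample, the residual energy has order at least `N^(2d+2)`
(`exists_residual_energy_ge`).

By the normal equations, the error matrix applied to one column of the input Gram matrix equals the
correlation of the residual with one coordinate of the current input (`IsOLS.error_equation`). The
residual depends only on strictly older inputs, so this correlation `Z` is a martingale transform: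
its second moment is the sum of the residual second moments, and its fourth moment is at most a
universal multiple of the square of the second (`correlation_moments`). Paley–Zygmund then gives
`|Z| ≳ N^(d+1)` with universal probability. The Gram column has norm `O(N)` outside an event of half
that probability (`integral_gram_column_le` and Markov), so the error is at least of order `N^d`.

Inconsistency is the case `d = 0`, where an eigenvalue of modulus one suffices. -/

namespace OLSLowerBound

/-! ### Moment calculus, Cauchy–Schwarz and Paley–Zygmund -/

section Moments

variable {Ω : Type*} [MeasurableSpace Ω] {μ : Measure Ω}

/-- All absolute moments of `X` are finite. -/
def HasMoments (μ : Measure Ω) (X : Ω → ℝ) : Prop := ∀ q : ENNReal, q ≠ ⊤ → MemLp X q μ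

lemma HasMoments.add {X Y : Ω → ℝ} (hX : HasMoments μ X) (hY : HasMoments μ Y) :
    HasMoments μ (fun ω => X ω + Y ω) := fun q hq => (hX q hq).add (hY q hq)

/-- Hölder with exponents `2q, 2q → q`. Finiteness of all moments is thus stable under polynomial
operations, which settles every later integrability question. -/
lemma HasMoments.mul {X Y : Ω → ℝ} (hX : HasMoments μ X) (hY : HasMoments μ Y) :
    HasMoments μ (fun ω => X ω * Y ω) := by
  intro q hq
  have h2 : (2 : ENNReal) * q ≠ ⊤ := ENNReal.mul_ne_top (by norm_num) hq
  have : ENNReal.HolderTriple (2 * q) (2 * q) q := ⟨by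
    rw [ENNReal.mul_inv (by simp) (by simp), ← two_mul, ← mul_assoc,
      ENNReal.mul_inv_cancel (by norm_num) (by norm_num), one_mul]⟩
  exact (hY _ h2).mul' (hX _ h2)

lemma hasMoments_const [IsFiniteMeasure μ] (c : ℝ) : HasMoments μ (fun _ => c) :=
  fun _ _ => memLp_const c

lemma HasMoments.const_mul {X : Ω → ℝ} (hX : HasMoments μ X) (c : ℝ) :
    HasMoments μ (fun ω => c * X ω) := fun q hq => (hX q hq).const_mul c

lemma HasMoments.pow [IsFiniteMeasure μ] {X : Ω → ℝ} (hX : HasMoments μ X) (k : ℕ) :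
    HasMoments μ (fun ω => X ω ^ k) := by
  induction k with
  | zero => simpa using hasMoments_const 1
  | succ k ih => simpa only [pow_succ] using ih.mul hX

lemma HasMoments.sum [IsFiniteMeasure μ] {ι : Type*} (s : Finset ι) {X : ι → Ω → ℝ}
    (hX : ∀ i ∈ s, HasMoments μ (X i)) : HasMoments μ (fun ω => ∑ i ∈ s, X i ω) :=
  fun q hq => memLp_finsetSum s fun i hi => hX i hi q hq

lemma HasMoments.integrable {X : Ω → ℝ} (hX : HasMoments μ X) : Integrable X μ :=
  memLp_one_iff_integrable.1 (hX 1 (by simp))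

lemma HasMoments.integral_add {X Y : Ω → ℝ} (hX : HasMoments μ X) (hY : HasMoments μ Y) :
    ∫ ω, X ω + Y ω ∂μ = (∫ ω, X ω ∂μ) + ∫ ω, Y ω ∂μ :=
  MeasureTheory.integral_add hX.integrable hY.integrable

/-- Cauchy–Schwarz, from the discriminant of the nonnegative quadratic `t ↦ ∫ (X + tY)²`. -/
lemma sq_integral_mul_le [IsFiniteMeasure μ] {X Y : Ω → ℝ} (hX : MemLp X 2 μ)
    (hY : MemLp Y 2 μ) :
    (∫ ω, X ω * Y ω ∂μ) ^ 2 ≤ (∫ ω, X ω ^ 2 ∂μ) * ∫ ω, Y ω ^ 2 ∂μ := by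
  have hXY : Integrable (fun ω => X ω * Y ω) μ := hX.integrable_mul hY
  have key : ∀ t : ℝ, 0 ≤ (∫ ω, Y ω ^ 2 ∂μ) * (t * t) + (2 * ∫ ω, X ω * Y ω ∂μ) * t
      + ∫ ω, X ω ^ 2 ∂μ := by
    intro t
    have h : ∫ ω, (X ω + t * Y ω) ^ 2 ∂μ = (∫ ω, Y ω ^ 2 ∂μ) * (t * t)
        + (2 * ∫ ω, X ω * Y ω ∂μ) * t + ∫ ω, X ω ^ 2 ∂μ := by
      have e : ∀ ω, (X ω + t * Y ω) ^ 2 = (t * t) * Y ω ^ 2 + (2 * t) * (X ω * Y ω) + X ω ^ 2 :=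
        fun ω => by ring
      simp_rw [e]
      have i12 : Integrable (fun ω => (t * t) * Y ω ^ 2 + (2 * t) * (X ω * Y ω)) μ :=
        (hY.integrable_sq.const_mul _).add (hXY.const_mul _)
      rw [integral_add i12 hX.integrable_sq,
        integral_add (hY.integrable_sq.const_mul _) (hXY.const_mul _), integral_const_mul,
        integral_const_mul]
      ring
    rw [← h]
    exact integral_nonneg fun ω => sq_nonneg _
  have := discrim_le_zero key
  rw [discrim] at this
  nlinarith

/-- The Paley–Zygmund inequality for `Z ^ 2` at level `1 / 2`. -/
lemma paleyZygmund_sq [IsProbabilityMeasure μ] {Z : Ω → ℝ} (hZm : Measurable Z)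
    (hZ : HasMoments μ Z) {κ : ℝ} (hκ : 0 < κ) (hpos : 0 < ∫ ω, Z ω ^ 2 ∂μ)
    (h4 : ∫ ω, Z ω ^ 4 ∂μ ≤ κ * (∫ ω, Z ω ^ 2 ∂μ) ^ 2) :
    1 / (4 * κ) ≤ μ.real {ω | (∫ ω, Z ω ^ 2 ∂μ) / 2 ≤ Z ω ^ 2} := by
  set V := ∫ ω, Z ω ^ 2 ∂μ with hV
  set S : Set Ω := {ω | V / 2 ≤ Z ω ^ 2} with hS
  have hSm : MeasurableSet S := measurableSet_le measurable_const (hZm.pow_const 2)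
  have hind : MemLp (S.indicator (fun _ => (1 : ℝ))) 2 μ := (memLp_const 1).indicator hSm
  have hZ2 : MemLp (fun ω => Z ω ^ 2) 2 μ := hZ.pow 2 2 (by simp)
  have hcs := sq_integral_mul_le hZ2 hind
  have e1 : ∫ ω, (S.indicator (fun _ => (1 : ℝ)) ω) ^ 2 ∂μ = μ.real S := by
    rw [← integral_indicator_one hSm]
    refine integral_congr_ae (ae_of_all _ fun ω => ?_)
    by_cases h : ω ∈ S <;> simp [h]
  have e2 : ∀ ω, (Z ω ^ 2) ^ 2 = Z ω ^ 4 := fun ω => by ring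
  rw [e1] at hcs
  simp_rw [e2] at hcs
  -- Off `S` the integrand `Z²` is below `V / 2`, so at least half of the second moment sits on `S`.
  have hlow : V / 2 ≤ ∫ ω, Z ω ^ 2 * S.indicator (fun _ => (1 : ℝ)) ω ∂μ := by
    have hint : Integrable (fun ω => Z ω ^ 2 * S.indicator (fun _ => (1 : ℝ)) ω) μ :=
      hZ2.integrable_mul hind
    have h1 : ∫ ω, Z ω ^ 2 ∂μ ≤
        ∫ ω, (V / 2 + Z ω ^ 2 * S.indicator (fun _ => (1 : ℝ)) ω) ∂μ := by
      refine integral_mono (hZ.pow 2).integrable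
        ((integrable_const _).add hint) fun ω => ?_
      by_cases h : ω ∈ S
      · simp [h]; positivity
      · simp only [h, not_false_eq_true, Set.indicator_of_notMem, mul_zero, add_zero]
        exact (not_le.1 h).le
    rw [integral_add (integrable_const _) hint] at h1
    simp only [integral_const, probReal_univ, one_smul, ← hV] at h1
    linarith
  have h5 : (V / 2) ^ 2 ≤ κ * V ^ 2 * μ.real S :=
    calc (V / 2) ^ 2 ≤ _ := pow_le_pow_left₀ (by positivity) hlow 2
      _ ≤ _ := hcs
      _ ≤ _ := mul_le_mul_of_nonneg_right h4 measureReal_nonneg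
  have hV2 : 0 < V ^ 2 := by positivity
  rw [div_le_iff₀ (by positivity)]
  by_contra hcon
  push Not at hcon
  have := mul_lt_mul_of_pos_left hcon hV2
  nlinarith

end Moments

/-! ### Moments of the standard Gaussian -/

section GaussianMoments

/-- The fourth moment of the standard Gaussian law. -/
noncomputable def gaussianFourth : ℝ := ∫ x, x ^ 4 ∂(gaussianReal 0 1)

lemma gaussianFourth_nonneg : 0 ≤ gaussianFourth :=
  integral_nonneg fun x => by positivity

lemma integral_sq_gaussianReal : ∫ x, x ^ 2 ∂(gaussianReal 0 1) = 1 := by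
  have h := variance_fun_id_gaussianReal (μ := 0) (v := 1)
  rw [variance_eq_integral measurable_id'.aemeasurable] at h
  simpa using h

lemma integral_cube_gaussianReal : ∫ x, x ^ 3 ∂(gaussianReal 0 1) = 0 := by
  have h : (gaussianReal 0 1).map (fun x : ℝ => -x) = gaussianReal 0 1 := by
    simp [gaussianReal_map_neg]
  have h2 : ∫ x, x ^ 3 ∂(gaussianReal 0 1) = ∫ x, (-x) ^ 3 ∂(gaussianReal 0 1) := by
    conv_lhs => rw [← h]
    rw [integral_map (by fun_prop) (by fun_prop)]
  have e : ∀ x : ℝ, (-x) ^ 3 = - x ^ 3 := fun x => by ring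
  simp_rw [e, integral_neg] at h2
  linarith

variable {Ω : Type*} [MeasurableSpace Ω] {μ : Measure Ω} {g : Ω → ℝ}

lemma hasMoments_of_hasLaw_gaussian (hg : HasLaw g (gaussianReal 0 1) μ) : HasMoments μ g := by
  intro q hq
  have h := memLp_id_gaussianReal' (μ := 0) (v := 1) q hq
  rw [← hg.map_eq, memLp_map_measure_iff (by fun_prop) hg.aemeasurable] at h
  exact h

lemma integral_pow_of_hasLaw_gaussian (hg : HasLaw g (gaussianReal 0 1) μ) (k : ℕ) :
    ∫ ω, g ω ^ k ∂μ = ∫ x, x ^ k ∂(gaussianReal 0 1) :=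
  hg.integral_comp (f := fun x : ℝ => x ^ k) (by fun_prop)

end GaussianMoments

/-! ### Functions not involving one coordinate of the family -/

section Free

variable {Ω : Type*} {ι : Type*} {W : ι → Ω → ℝ}

/-- `X` is a measurable function of the variables `W j` with `j ≠ i`. -/
def FreeOf (W : ι → Ω → ℝ) (i : ι) (X : Ω → ℝ) : Prop :=
  Measurable[⨆ j ∈ ({i}ᶜ : Set ι), MeasurableSpace.comap (W j) inferInstance] X

lemma freeOf_coord {i j : ι} (h : j ≠ i) : FreeOf W i (W j) := by
  refine Measurable.mono (comap_measurable (W j)) ?_ le_rfl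
  exact le_iSup₂ (f := fun j (_ : j ∈ ({i}ᶜ : Set ι)) =>
    MeasurableSpace.comap (W j) inferInstance) j h

lemma freeOf_const {i : ι} (c : ℝ) : FreeOf W i (fun _ => c) := by
  unfold FreeOf; exact measurable_const

lemma FreeOf.add {i : ι} {X Y : Ω → ℝ} (hX : FreeOf W i X) (hY : FreeOf W i Y) :
    FreeOf W i (fun ω => X ω + Y ω) := by
  unfold FreeOf at *; exact Measurable.add hX hY

lemma FreeOf.mul {i : ι} {X Y : Ω → ℝ} (hX : FreeOf W i X) (hY : FreeOf W i Y) :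
    FreeOf W i (fun ω => X ω * Y ω) := by
  unfold FreeOf at *; exact Measurable.mul hX hY

lemma FreeOf.pow {i : ι} {X : Ω → ℝ} (hX : FreeOf W i X) (k : ℕ) :
    FreeOf W i (fun ω => X ω ^ k) := by
  unfold FreeOf at *; exact Measurable.pow_const hX k

lemma FreeOf.sum {i : ι} {κ : Type*} (s : Finset κ) {X : κ → Ω → ℝ}
    (hX : ∀ k ∈ s, FreeOf W i (X k)) : FreeOf W i (fun ω => ∑ k ∈ s, X k ω) := by
  unfold FreeOf at *; exact Finset.measurable_fun_sum s hX

variable [MeasurableSpace Ω] {μ : Measure Ω}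

lemma FreeOf.measurable {i : ι} {X : Ω → ℝ} (hW : ∀ i, Measurable (W i)) (hX : FreeOf W i X) :
    Measurable X :=
  Measurable.mono hX (iSup₂_le fun j _ => (hW j).comap_le) le_rfl

/-- Disjoint blocks of indices of an independent family generate independent σ-algebras. -/
lemma FreeOf.indepFun {i : ι} {X : Ω → ℝ} (hW : ∀ i, Measurable (W i)) (hi : iIndepFun W μ)
    (hX : FreeOf W i X) : IndepFun X (W i) μ := by
  have h : Indep (⨆ j ∈ ({i}ᶜ : Set ι), MeasurableSpace.comap (W j) inferInstance)
      (⨆ j ∈ ({i} : Set ι), MeasurableSpace.comap (W j) inferInstance) μ :=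
    indep_iSup_of_disjoint (fun k => (hW k).comap_le) hi (by simp)
  rw [iSup_singleton] at h
  exact indep_of_indep_of_le_left h hX.comap_le

end Free

/-! ### Second and fourth moments of affine forms and martingale transforms -/

/-- The family `W` consists of independent standard Gaussian variables. -/
structure IsStdGaussianFamily {Ω : Type*} [MeasurableSpace Ω] {ι : Type*} (μ : Measure Ω)
    (W : ι → Ω → ℝ) : Prop where
  meas : ∀ i, Measurable (W i)
  indep : iIndepFun W μ
  law : ∀ i, HasLaw (W i) (gaussianReal 0 1) μ

section Family

variable {Ω : Type*} [mΩ : MeasurableSpace Ω] {μ : Measure Ω}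
  {ι : Type*} {W : ι → Ω → ℝ}

lemma IsStdGaussianFamily.hasMoments (hW : IsStdGaussianFamily μ W) (i : ι) :
    HasMoments μ (W i) := hasMoments_of_hasLaw_gaussian (hW.law i)

lemma IsStdGaussianFamily.integral_mul_pow (hW : IsStdGaussianFamily μ W) {i : ι} {X : Ω → ℝ}
    (hX : FreeOf W i X) (k : ℕ) :
    ∫ ω, X ω * W i ω ^ k ∂μ = (∫ ω, X ω ∂μ) * ∫ x, x ^ k ∂(gaussianReal 0 1) := by
  rw [← integral_pow_of_hasLaw_gaussian (hW.law i)]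
  have h : IndepFun X (fun ω => W i ω ^ k) μ :=
    (hX.indepFun hW.meas hW.indep).comp (φ := id) (ψ := fun x => x ^ k) measurable_id
      (by fun_prop)
  exact h.integral_fun_mul_eq_mul_integral (hX.measurable hW.meas).aestronglyMeasurable
    ((hW.meas i).pow_const k).aestronglyMeasurable

variable [IsProbabilityMeasure μ]

/-- The cross term vanishes because `W i` is centred and independent of `X Y`. This is the one-step
orthogonality behind both inductions below. -/
lemma IsStdGaussianFamily.integral_sq_step (hW : IsStdGaussianFamily μ W) {i : ι}
    {X Y : Ω → ℝ} (hX : FreeOf W i X) (hY : FreeOf W i Y) (hXm : HasMoments μ X)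
    (hYm : HasMoments μ Y) :
    ∫ ω, (X ω + Y ω * W i ω) ^ 2 ∂μ = (∫ ω, X ω ^ 2 ∂μ) + ∫ ω, Y ω ^ 2 ∂μ := by
  have e : ∀ ω, (X ω + Y ω * W i ω) ^ 2
      = X ω ^ 2 + (2 * (X ω * Y ω)) * W i ω ^ 1 + Y ω ^ 2 * W i ω ^ 2 := fun ω => by ring
  simp_rw [e]
  have hg := hW.hasMoments i
  have i1 := (hXm.pow 2)
  have i2 := (((hXm.mul hYm).const_mul 2).mul (hg.pow 1))
  have i3 := ((hYm.pow 2).mul (hg.pow 2))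
  rw [(i1.add i2).integral_add i3, i1.integral_add i2,
    hW.integral_mul_pow ((freeOf_const 2).mul (hX.mul hY)), hW.integral_mul_pow (hY.pow 2),
    integral_sq_gaussianReal]
  simp

/-- In the binomial expansion the odd powers of `W i` integrate to zero. The mixed moment of `X` and
`Y` is kept, since the two need not be independent of each other. -/
lemma IsStdGaussianFamily.integral_fourth_step (hW : IsStdGaussianFamily μ W) {i : ι}
    {X Y : Ω → ℝ} (hX : FreeOf W i X) (hY : FreeOf W i Y) (hXm : HasMoments μ X)
    (hYm : HasMoments μ Y) :
    ∫ ω, (X ω + Y ω * W i ω) ^ 4 ∂μ = (∫ ω, X ω ^ 4 ∂μ) + 6 * (∫ ω, X ω ^ 2 * Y ω ^ 2 ∂μ)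
      + gaussianFourth * ∫ ω, Y ω ^ 4 ∂μ := by
  have e : ∀ ω, (X ω + Y ω * W i ω) ^ 4
      = X ω ^ 4 + (4 * (X ω ^ 3 * Y ω)) * W i ω ^ 1 + (6 * (X ω ^ 2 * Y ω ^ 2)) * W i ω ^ 2
        + (4 * (X ω * Y ω ^ 3)) * W i ω ^ 3 + Y ω ^ 4 * W i ω ^ 4 := fun ω => by ring
  simp_rw [e]
  have hg := hW.hasMoments i
  have i1 := (hXm.pow 4)
  have i2 := ((((hXm.pow 3).mul hYm).const_mul 4).mul (hg.pow 1))
  have i3 := ((((hXm.pow 2).mul (hYm.pow 2)).const_mul 6).mul (hg.pow 2))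
  have i4 := (((hXm.mul (hYm.pow 3)).const_mul 4).mul (hg.pow 3))
  have i5 := ((hYm.pow 4).mul (hg.pow 4))
  rw [(((i1.add i2).add i3).add i4).integral_add i5, ((i1.add i2).add i3).integral_add i4,
    (i1.add i2).integral_add i3, i1.integral_add i2,
    hW.integral_mul_pow ((freeOf_const 4).mul ((hX.pow 3).mul hY)),
    hW.integral_mul_pow ((freeOf_const 6).mul ((hX.pow 2).mul (hY.pow 2))),
    hW.integral_mul_pow ((freeOf_const 4).mul (hX.mul (hY.pow 3))),
    hW.integral_mul_pow (hY.pow 4), integral_sq_gaussianReal, integral_cube_gaussianReal,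
    integral_const_mul 6]
  simp [gaussianFourth, mul_comm]

/-- Second and fourth moments of an affine function of independent standard Gaussians. -/
lemma IsStdGaussianFamily.affine_moments (hW : IsStdGaussianFamily μ W) (b : ℝ) (h : ι → ℝ)
    (s : Finset ι) :
    (∫ ω, (b + ∑ q ∈ s, h q * W q ω) ^ 2 ∂μ) = b ^ 2 + ∑ q ∈ s, h q ^ 2 ∧
    (∫ ω, (b + ∑ q ∈ s, h q * W q ω) ^ 4 ∂μ)
      ≤ (gaussianFourth + 3) * (b ^ 2 + ∑ q ∈ s, h q ^ 2) ^ 2 := by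
  classical
  have hM := gaussianFourth_nonneg
  induction s using Finset.induction_on with
  | empty => simp; nlinarith [sq_nonneg (b ^ 2)]
  | insert i s hi ih =>
    obtain ⟨ih2, ih4⟩ := ih
    have hX : FreeOf W i (fun ω => b + ∑ q ∈ s, h q * W q ω) :=
      (freeOf_const b).add (FreeOf.sum s fun q hq => (freeOf_const (h q)).mul
        (freeOf_coord (fun e => hi (e ▸ hq))))
    have hXm : HasMoments μ (fun ω => b + ∑ q ∈ s, h q * W q ω) :=
      (hasMoments_const b).add (HasMoments.sum s fun q _ => (hW.hasMoments q).const_mul (h q))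
    have e : ∀ ω, b + ∑ q ∈ insert i s, h q * W q ω
        = (b + ∑ q ∈ s, h q * W q ω) + h i * W i ω := fun ω => by
      rw [Finset.sum_insert hi]; ring
    simp_rw [e]
    rw [hW.integral_sq_step hX (freeOf_const (h i)) hXm (hasMoments_const _),
      hW.integral_fourth_step hX (freeOf_const (h i)) hXm (hasMoments_const _),
      integral_mul_const, ih2, Finset.sum_insert hi]
    simp only [integral_const, probReal_univ, one_smul]
    refine ⟨by ring, ?_⟩
    -- The new cross term is `6 V (h i)²`; the square on the right offers `2 (gaussianFourth + 3) V
    -- (h i)²`, which is why 3 is added.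
    rw [show b ^ 2 + (h i ^ 2 + ∑ q ∈ s, h q ^ 2) = (b ^ 2 + ∑ q ∈ s, h q ^ 2) + h i ^ 2 by ring]
    have hV : 0 ≤ b ^ 2 + ∑ q ∈ s, h q ^ 2 := by positivity
    generalize b ^ 2 + ∑ q ∈ s, h q ^ 2 = V at *
    have h1 : 0 ≤ gaussianFourth * (V * h i ^ 2) := by positivity
    nlinarith [sq_nonneg (h i ^ 2)]

/-- Second and fourth moments of a martingale transform of independent standard Gaussians. -/
lemma IsStdGaussianFamily.transform_moments (hW : IsStdGaussianFamily μ W) (i : ℕ → ι)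
    (ξ : ℕ → Ω → ℝ) (a : ℕ) (hi : Function.Injective i)
    -- All coefficients up to time `t` must avoid `W (i t)`, because in the inductive step the whole
    -- partial sum plays the role of `X`.
    (hfree : ∀ t, a ≤ t → ∀ s, a ≤ s → s ≤ t → FreeOf W (i t) (ξ s))
    (hm : ∀ t, HasMoments μ (ξ t))
    (N : ℕ) (hN : a ≤ N) :
    (∫ ω, (∑ t ∈ Finset.Ico a N, ξ t ω * W (i t) ω) ^ 2 ∂μ)
        = ∑ t ∈ Finset.Ico a N, ∫ ω, ξ t ω ^ 2 ∂μ ∧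
    ((∀ t, ∫ ω, ξ t ω ^ 4 ∂μ ≤ (gaussianFourth + 3) * (∫ ω, ξ t ω ^ 2 ∂μ) ^ 2) →
      ∫ ω, (∑ t ∈ Finset.Ico a N, ξ t ω * W (i t) ω) ^ 4 ∂μ
        ≤ 9 * (gaussianFourth + 3) ^ 2 * (∑ t ∈ Finset.Ico a N, ∫ ω, ξ t ω ^ 2 ∂μ) ^ 2) := by
  induction N, hN using Nat.le_induction with
  | base => simp
  | succ N hN ih =>
    obtain ⟨ih2, ih4⟩ := ih
    have hX : FreeOf W (i N) (fun ω => ∑ t ∈ Finset.Ico a N, ξ t ω * W (i t) ω) := by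
      refine FreeOf.sum _ fun t ht => ?_
      rw [Finset.mem_Ico] at ht
      exact (hfree N hN t ht.1 ht.2.le).mul (freeOf_coord fun e => ht.2.ne (hi e))
    have hY := hfree N hN N hN le_rfl
    have hXm : HasMoments μ (fun ω => ∑ t ∈ Finset.Ico a N, ξ t ω * W (i t) ω) :=
      HasMoments.sum _ fun t _ => (hm t).mul (hW.hasMoments _)
    simp_rw [Finset.sum_Ico_succ_top hN]
    rw [hW.integral_sq_step hX hY hXm (hm N), hW.integral_fourth_step hX hY hXm (hm N), ih2]
    refine ⟨rfl, fun h4 => ?_⟩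
    have hc := sq_integral_mul_le (hXm.pow 2 2 (by simp)) ((hm N).pow 2 2 (by simp))
    simp_rw [← pow_mul] at hc
    norm_num at hc
    have hX4 := ih4 h4
    have hY4 := h4 N
    have hM := gaussianFourth_nonneg
    have hV : 0 ≤ ∑ t ∈ Finset.Ico a N, ∫ ω, ξ t ω ^ 2 ∂μ :=
      Finset.sum_nonneg fun t _ => integral_nonneg fun ω => sq_nonneg _
    have hv : 0 ≤ ∫ ω, ξ N ω ^ 2 ∂μ := integral_nonneg fun ω => sq_nonneg _
    have hY4' : 0 ≤ ∫ ω, ξ N ω ^ 4 ∂μ := integral_nonneg fun ω => by positivity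
    generalize (∑ t ∈ Finset.Ico a N, ∫ ω, ξ t ω ^ 2 ∂μ) = V at *
    generalize (∫ ω, ξ N ω ^ 2 ∂μ) = v at *
    generalize (∫ ω, ξ N ω ^ 4 ∂μ) = Y4 at *
    generalize (∫ ω, (∑ t ∈ Finset.Ico a N, ξ t ω * W (i t) ω) ^ 4 ∂μ) = X4 at *
    generalize (∫ ω, (∑ t ∈ Finset.Ico a N, ξ t ω * W (i t) ω) ^ 2 * ξ N ω ^ 2 ∂μ) = XY at *
    generalize hG : gaussianFourth = G at *
    -- Cauchy–Schwarz for the mixed moment. Six times this bound is exactly the cross term `18 (G +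
    -- 3)² V v` of the target, which fixes the constant 9.
    have hXY : XY ≤ 3 * (G + 3) ^ 2 * (V * v) := by
      refine abs_le_of_sq_le_sq' ?_ (by positivity) |>.2
      calc XY ^ 2 ≤ X4 * Y4 := hc
        _ ≤ (9 * (G + 3) ^ 2 * V ^ 2) * ((G + 3) * v ^ 2) :=
            mul_le_mul hX4 hY4 hY4' (by positivity)
        _ = (G + 3) ^ 3 * (9 * (V * v) ^ 2) := by ring
        _ ≤ (G + 3) ^ 4 * (9 * (V * v) ^ 2) := by
            refine mul_le_mul_of_nonneg_right ?_ (by positivity)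
            exact pow_le_pow_right₀ (by linarith) (by norm_num)
        _ = _ := by ring
    have hGY : G * Y4 ≤ G * ((G + 3) * v ^ 2) := mul_le_mul_of_nonneg_left hY4 hM
    have h5 : G * ((G + 3) * v ^ 2) ≤ 9 * (G + 3) ^ 2 * v ^ 2 := by
      have : 0 ≤ v ^ 2 * (8 * G ^ 2 + 51 * G + 81) := by positivity
      nlinarith
    nlinarith

end Family

/-! ### Growth of matrix powers and of the Markov parameters -/

section Growth

/-- A witness for the growth of `‖A ^ r‖` at least like the binomial coefficient `r.choose d`. -/
def HasGrowthWitness {n : ℕ} (A : Matrix (Fin n) (Fin n) ℝ) (d : ℕ) : Prop :=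
  ∃ a b : Fin n → ℂ, ∀ r : ℕ,
    ‖a ⬝ᵥ ((A.map fun x : ℝ => (x : ℂ)) ^ r *ᵥ b)‖ = (r.choose d : ℝ)

lemma jordanBlock_pow_apply (ev : ℂ) (k r : ℕ) (i j : Fin k) :
    (jordanBlock ev k ^ r) i j =
      if i ≤ j then (r.choose (j.val - i.val) : ℂ) * ev ^ (r - (j.val - i.val)) else 0 := by
  induction r generalizing i with
  | zero =>
    rw [pow_zero, Matrix.one_apply]
    rcases lt_trichotomy i j with h | rfl | h
    · rw [if_neg h.ne, if_pos h.le, Nat.choose_eq_zero_of_lt (by omega)]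
      simp
    · simp
    · rw [if_neg h.ne', if_neg (not_le.2 h)]
  | succ r ih =>
    have hsplit : ∀ l, jordanBlock ev k i l =
        (if i = l then ev else 0) + if i.val + 1 = l.val then 1 else 0 := by
      intro l
      simp only [jordanBlock, Matrix.of_apply]
      by_cases h : i = l
      · subst h; simp
      · simp [h]
    rw [pow_succ', Matrix.mul_apply]
    simp_rw [hsplit, add_mul, Finset.sum_add_distrib, ite_mul, zero_mul, one_mul]
    rw [Finset.sum_ite_eq Finset.univ i, if_pos (Finset.mem_univ i), ih]
    rcases lt_trichotomy i j with h | rfl | h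
    · have hlt : i.val < j.val := h
      have hk : i.val + 1 < k := by omega
      rw [Finset.sum_eq_single (⟨i.val + 1, hk⟩ : Fin k)
        (fun l _ hl => if_neg fun e => hl (Fin.ext e.symm)) (by simp), if_pos rfl, ih,
        if_pos h.le, if_pos (Fin.le_def.2 (by simpa using hlt)), if_pos h.le]
      obtain ⟨q, hq⟩ : ∃ q, j.val - i.val = q + 1 := ⟨j.val - i.val - 1, by omega⟩
      rw [show j.val - (i.val + 1) = q by omega, hq, Nat.choose_succ_succ, Nat.succ_sub_succ]
      rcases le_or_gt (q + 1) r with hr | hr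
      · rw [show r - q = r - (q + 1) + 1 by omega, pow_succ]
        push_cast
        ring
      · rw [Nat.choose_eq_zero_of_lt hr]
        push_cast
        ring
    · rw [Finset.sum_eq_zero fun l _ => ?_]
      · simp [pow_succ']
      · split_ifs with h1
        · rw [ih, if_neg]
          rw [Fin.le_def]
          omega
        · rfl
    · have hlt : j.val < i.val := h
      rw [if_neg (not_le.2 h), if_neg (not_le.2 h), Finset.sum_eq_zero fun l _ => ?_]
      · simp
      · split_ifs with h1
        · rw [ih, if_neg]
          rw [Fin.le_def]
          omega
        · rfl

lemma HasJordanBlock.hasGrowthWitness {n k : ℕ} {A : Matrix (Fin n) (Fin n) ℝ} {ev : ℂ}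
    (hev : ‖ev‖ = 1) (h : HasJordanBlock A ev k) : 1 ≤ k ∧ HasGrowthWitness A (k - 1) := by
  obtain ⟨r, size, eig, e, S, hsize, hS, hA, i, rfl, rfl⟩ := h
  refine ⟨hsize i, ?_⟩
  set J := Matrix.reindex e e (Matrix.blockDiagonal' fun i => jordanBlock (eig i) (size i)) with hJ
  have hpow : ∀ q : ℕ, (A.map fun x : ℝ => (x : ℂ)) ^ q = S * J ^ q * S⁻¹ := by
    intro q
    rw [hA]
    induction q with
    | zero => simp [Matrix.mul_nonsing_inv S ((Matrix.isUnit_iff_isUnit_det S).1 hS)]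
    | succ q ih =>
      rw [pow_succ, ih, pow_succ]
      simp only [Matrix.mul_assoc]
      rw [← Matrix.mul_assoc S⁻¹ S, Matrix.nonsing_inv_mul S ((Matrix.isUnit_iff_isUnit_det S).1 hS),
        Matrix.one_mul]
  have hJpow : ∀ q : ℕ, J ^ q = Matrix.reindex e e
      (Matrix.blockDiagonal' fun i => jordanBlock (eig i) (size i) ^ q) := by
    intro q
    have h1 : (Matrix.blockDiagonal' fun i => jordanBlock (eig i) (size i) ^ q)
        = (Matrix.blockDiagonal' fun i => jordanBlock (eig i) (size i)) ^ q :=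
      Matrix.blockDiagonal'_pow (fun i => jordanBlock (eig i) (size i)) q
    rw [h1, hJ]
    exact (map_pow (Matrix.reindexAlgEquiv ℂ ℂ e) _ q).symm
  have hs := hsize i
  let i0 : Fin (size i) := ⟨0, hs⟩
  let j0 : Fin (size i) := ⟨size i - 1, by omega⟩
  -- These vectors read off the top right corner of the block, where the `q`-th power has the entry
  -- of largest binomial order; the eigenvalue factor has modulus one.
  refine ⟨(S⁻¹)ᵀ *ᵥ Pi.single (e ⟨i, i0⟩) 1, S *ᵥ Pi.single (e ⟨i, j0⟩) 1, fun q => ?_⟩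
  have h2 : ((S⁻¹)ᵀ *ᵥ Pi.single (e ⟨i, i0⟩) 1) ⬝ᵥ
      ((A.map fun x : ℝ => (x : ℂ)) ^ q *ᵥ (S *ᵥ Pi.single (e ⟨i, j0⟩) 1))
      = (jordanBlock (eig i) (size i) ^ q) i0 j0 := by
    rw [hpow, Matrix.mulVec_transpose, ← Matrix.dotProduct_mulVec, Matrix.mulVec_mulVec,
      Matrix.mulVec_mulVec]
    have hS' := Matrix.nonsing_inv_mul S ((Matrix.isUnit_iff_isUnit_det S).1 hS)
    rw [show S⁻¹ * (S * J ^ q * S⁻¹) * S = J ^ q by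
      rw [Matrix.mul_assoc, Matrix.mul_assoc (S * J ^ q), hS', Matrix.mul_one, ← Matrix.mul_assoc,
        hS', Matrix.one_mul], hJpow]
    simp [Matrix.blockDiagonal'_apply]
  rw [h2, jordanBlock_pow_apply]
  simp [i0, j0, Fin.le_def, hev]

/-- The spectral radius is attained at an eigenvalue of modulus one, and along its eigenvector the
powers of `A` neither grow nor decay. -/
lemma hasGrowthWitness_zero_of_spectralRadius {n : ℕ} {A : Matrix (Fin n) (Fin n) ℝ}
    (h : spectralRadius ℂ (A.map fun a : ℝ => (a : ℂ)) = 1) : HasGrowthWitness A 0 := by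
  set Ac := A.map fun a : ℝ => (a : ℂ) with hAc
  have hne : (spectrum ℂ Ac).Nonempty := by
    by_contra hcon
    rw [Set.not_nonempty_iff_eq_empty] at hcon
    simp [spectralRadius, hcon] at h
  obtain ⟨ev, hev, hnorm⟩ := spectrum.exists_nnnorm_eq_spectralRadius_of_nonempty hne
  rw [h] at hnorm
  have hn1 : ‖ev‖ = 1 := by
    have : ‖ev‖₊ = 1 := by exact_mod_cast hnorm
    simpa using congrArg NNReal.toReal this
  rw [← Matrix.spectrum_toLin'] at hev
  rw [← Module.End.hasEigenvalue_iff_mem_spectrum] at hev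
  obtain ⟨v, hv⟩ := hev.exists_hasEigenvector
  have hpow : ∀ r : ℕ, Ac ^ r *ᵥ v = ev ^ r • v := by
    intro r
    have := hv.pow_apply r
    rwa [← Matrix.toLin'_pow, Matrix.toLin'_apply] at this
  obtain ⟨i, hi⟩ : ∃ i, v i ≠ 0 := Function.ne_iff.1 hv.2
  refine ⟨Pi.single i (v i)⁻¹, v, fun r => ?_⟩
  rw [hpow]
  simp [hn1, hi]

/-- The squared Frobenius norm of the Markov parameter `C A ^ r B`. -/
noncomputable def markovSq {n m p : ℕ} (A : Matrix (Fin n) (Fin n) ℝ)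
    (B : Matrix (Fin n) (Fin p) ℝ) (C : Matrix (Fin m) (Fin n) ℝ) (r : ℕ) : ℝ :=
  ∑ i, ∑ l, ((C * A ^ r * B) i l) ^ 2

variable {n m p : ℕ} {A : Matrix (Fin n) (Fin n) ℝ}
  {B : Matrix (Fin n) (Fin p) ℝ} {C : Matrix (Fin m) (Fin n) ℝ}

lemma markovSq_nonneg (r : ℕ) : 0 ≤ markovSq A B C r :=
  Finset.sum_nonneg fun _ _ => Finset.sum_nonneg fun _ _ => sq_nonneg _

/-- Full row rank gives surjectivity over the reals; real and imaginary parts are solved separately.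
It serves to write the complex growth witnesses through the real controllability and observability
matrices. -/
lemma exists_complex_mulVec_eq_of_rank {ι κ : Type*} [Fintype ι] [Fintype κ]
    (M : Matrix ι κ ℝ) (h : M.rank = Fintype.card ι) (b : ι → ℂ) :
    ∃ β : κ → ℂ, (M.map fun x : ℝ => (x : ℂ)) *ᵥ β = b := by
  have hsurj : Function.Surjective M.mulVecLin := by
    rw [← LinearMap.range_eq_top]
    apply Submodule.eq_top_of_finrank_eq
    rw [← Matrix.rank, h, Module.finrank_pi]
  obtain ⟨x, hx⟩ := hsurj (fun i => (b i).re)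
  obtain ⟨y, hy⟩ := hsurj (fun i => (b i).im)
  refine ⟨fun j => ⟨x j, y j⟩, ?_⟩
  ext i
  have hx' := congrFun hx i
  have hy' := congrFun hy i
  simp only [Matrix.mulVecLin_apply, Matrix.mulVec, dotProduct] at hx' hy'
  apply Complex.ext
  · simp [Matrix.mulVec, dotProduct, ← hx']
  · simp [Matrix.mulVec, dotProduct, ← hy']

/-- Minimality transfers the growth of `A ^ r` to the Markov parameters. -/
lemma exists_choose_sq_le (hmin : IsMinimal (m := m) A B C) {d : ℕ} (hg : HasGrowthWitness A d) :
    ∃ c : ℝ, 0 < c ∧ ∀ r : ℕ, (r.choose d : ℝ) ^ 2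
      ≤ c * ∑ i : Fin n, ∑ j : Fin n, markovSq A B C (r + (i + j)) := by
  obtain ⟨a, b, hab⟩ := hg
  obtain ⟨β, hβ⟩ := exists_complex_mulVec_eq_of_rank (controllabilityMatrix A B)
    (by rw [hmin.1, Fintype.card_fin]) b
  obtain ⟨α, hα⟩ := exists_complex_mulVec_eq_of_rank (observabilityMatrix A C)ᵀ
    (by rw [Matrix.rank_transpose, hmin.2, Fintype.card_fin]) a
  -- The blocks of observability matrix times `A^r` times controllability matrix are the Markov
  -- parameters of index `r + i + j`, so the growing form is a fixed combination of them.
  have key : ∀ r : ℕ, a ⬝ᵥ ((A.map fun x : ℝ => (x : ℂ)) ^ r *ᵥ b)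
      = ∑ x : (Fin n × Fin m) × (Fin n × Fin p), (α x.1 * β x.2) *
        (((C * A ^ (r + (x.1.1 + x.2.1)) * B) x.1.2 x.2.2 : ℝ) : ℂ) := by
    intro r
    have hent : ∀ x : (Fin n × Fin m) × (Fin n × Fin p),
        (observabilityMatrix A C * A ^ r * controllabilityMatrix A B) x.1 x.2
          = (C * A ^ (r + (x.1.1 + x.2.1)) * B) x.1.2 x.2.2 := by
      intro x
      rw [show C * A ^ (r + (x.1.1 + x.2.1)) * B = (C * A ^ (x.1.1 : ℕ)) * A ^ r *
        (A ^ (x.2.1 : ℕ) * B) by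
          rw [show r + ((x.1.1 : ℕ) + x.2.1) = x.1.1 + r + x.2.1 by ring, pow_add, pow_add]
          simp only [Matrix.mul_assoc]]
      rfl
    have hmap : ((observabilityMatrix A C * A ^ r * controllabilityMatrix A B).map
        fun x : ℝ => (x : ℂ)) = (observabilityMatrix A C).map (fun x : ℝ => (x : ℂ)) *
          (A.map fun x : ℝ => (x : ℂ)) ^ r *
          (controllabilityMatrix A B).map (fun x : ℝ => (x : ℂ)) := by
      have hp : (A ^ r).map (Complex.ofRealHom) = (A.map Complex.ofRealHom) ^ r :=
        Matrix.map_pow A Complex.ofRealHom r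
      change Matrix.map _ Complex.ofRealHom = _
      rw [Matrix.map_mul, Matrix.map_mul, hp]
      rfl
    rw [← hβ, ← hα, Matrix.transpose_map, Matrix.mulVec_transpose, ← Matrix.dotProduct_mulVec,
      Matrix.mulVec_mulVec, Matrix.mulVec_mulVec, ← hmap]
    simp only [dotProduct, Matrix.mulVec, Finset.mul_sum, Matrix.map_apply]
    refine Eq.trans ?_ (Fintype.sum_prod_type _).symm
    refine Finset.sum_congr rfl fun x _ => Finset.sum_congr rfl fun y _ => ?_
    rw [← hent (x, y)]
    ring
  refine ⟨∑ x : (Fin n × Fin m) × (Fin n × Fin p), ‖α x.1 * β x.2‖ ^ 2 + 1, by positivity,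
    fun r => ?_⟩
  rw [← hab r, key r]
  have hsum : ∑ x : (Fin n × Fin m) × (Fin n × Fin p),
      ((C * A ^ (r + (x.1.1 + x.2.1)) * B) x.1.2 x.2.2) ^ 2
      = ∑ i : Fin n, ∑ j : Fin n, markovSq A B C (r + (i + j)) := by
    simp only [Fintype.sum_prod_type, markovSq]
    refine Finset.sum_congr rfl fun i _ => Finset.sum_comm
  calc _ ≤ (∑ x : (Fin n × Fin m) × (Fin n × Fin p), ‖α x.1 * β x.2‖ *
        ‖(C * A ^ (r + (x.1.1 + x.2.1)) * B) x.1.2 x.2.2‖) ^ 2 := by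
        refine pow_le_pow_left₀ (norm_nonneg _) ((norm_sum_le _ _).trans_eq ?_) 2
        exact Finset.sum_congr rfl fun x _ => by rw [norm_mul, Complex.norm_real]
    _ ≤ (∑ x : (Fin n × Fin m) × (Fin n × Fin p), ‖α x.1 * β x.2‖ ^ 2) *
        ∑ x : (Fin n × Fin m) × (Fin n × Fin p),
          ‖(C * A ^ (r + (x.1.1 + x.2.1)) * B) x.1.2 x.2.2‖ ^ 2 :=
        Finset.sum_mul_sq_le_sq_mul_sq _ _ _
    _ ≤ _ := by
        simp only [Real.norm_eq_abs, sq_abs] at *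
        rw [← hsum]
        exact mul_le_mul_of_nonneg_right (by linarith)
          (Finset.sum_nonneg fun _ _ => sq_nonneg _)

/-- The accumulated energy of the Markov parameters grows at least like `R ^ (2 d + 1)`. -/
lemma exists_sum_markovSq_ge (hmin : IsMinimal (m := m) A B C) {d : ℕ}
    (hg : HasGrowthWitness A d) :
    ∃ c : ℝ, 0 < c ∧ ∃ R₀ : ℕ, ∀ R : ℕ, R₀ ≤ R →
      c * (R : ℝ) ^ (2 * d + 1) ≤ ∑ r ∈ Finset.range R, markovSq A B C r := by
  obtain ⟨c, hc, hle⟩ := exists_choose_sq_le hmin hg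
  set F : ℕ → ℝ := fun R => ∑ r ∈ Finset.range R, markovSq A B C r with hF
  have hFmono : Monotone F := fun R S h => Finset.sum_le_sum_of_subset_of_nonneg
    (Finset.range_mono h) fun _ _ _ => markovSq_nonneg _
  have hshift : ∀ R s : ℕ, ∑ r ∈ Finset.range R, markovSq A B C (r + s) ≤ F (R + s) := by
    intro R s
    simp only [hF]
    rw [add_comm R s, Finset.sum_range_add]
    simp_rw [add_comm _ s]
    exact le_add_of_nonneg_left (Finset.sum_nonneg fun _ _ => markovSq_nonneg _)
  -- The `n²` shifts `i + j` are below `2n`, so each shifted sum fits in a window longer by `2n`.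
  -- The extra `+ 1` keeps the constant positive when `n = 0`.
  have hup : ∀ R : ℕ, ∑ r ∈ Finset.range R, (r.choose d : ℝ) ^ 2
      ≤ c * ((n : ℝ) ^ 2 + 1) * F (R + 2 * n) := by
    intro R
    calc _ ≤ ∑ r ∈ Finset.range R, c * ∑ i : Fin n, ∑ j : Fin n, markovSq A B C (r + (i + j)) :=
          Finset.sum_le_sum fun r _ => hle r
      _ = c * ∑ i : Fin n, ∑ j : Fin n, ∑ r ∈ Finset.range R, markovSq A B C (r + (i + j)) := by
          rw [← Finset.mul_sum, Finset.sum_comm]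
          congr 1
          refine Finset.sum_congr rfl fun i _ => Finset.sum_comm
      _ ≤ c * ∑ i : Fin n, ∑ j : Fin n, F (R + 2 * n) := by
          gcongr with i _ j _
          exact (hshift _ _).trans (hFmono (by omega))
      _ ≤ _ := by
          have hF0 : 0 ≤ F (R + 2 * n) := Finset.sum_nonneg fun _ _ => markovSq_nonneg _
          simp only [Finset.sum_const, Finset.card_univ, Fintype.card_fin, nsmul_eq_mul]
          nlinarith [mul_nonneg hc.le hF0]
  have hfac : (0 : ℝ) < (d.factorial : ℝ) := by exact_mod_cast d.factorial_pos
  -- Only the last `q` indices are used: there `r.choose d ≥ q^d / d!`.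
  have hlow : ∀ q : ℕ, (q : ℝ) ^ (2 * d + 1) / (d.factorial : ℝ) ^ 2
      ≤ ∑ r ∈ Finset.range (2 * q + d), (r.choose d : ℝ) ^ 2 := by
    intro q
    have hsub : Finset.Ico (q + d) (2 * q + d) ⊆ Finset.range (2 * q + d) := fun r hr => by
      simp only [Finset.mem_Ico, Finset.mem_range] at *; omega
    refine le_trans ?_ (Finset.sum_le_sum_of_subset_of_nonneg hsub fun _ _ _ => sq_nonneg _)
    have hterm : ∀ r ∈ Finset.Ico (q + d) (2 * q + d),
        ((q : ℝ) ^ d / d.factorial) ^ 2 ≤ (r.choose d : ℝ) ^ 2 := by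
      intro r hr
      rw [Finset.mem_Ico] at hr
      refine pow_le_pow_left₀ (by positivity) ?_ 2
      refine le_trans (div_le_div_of_nonneg_right ?_ hfac.le) (Nat.pow_le_choose (α := ℝ) d r)
      exact pow_le_pow_left₀ (by positivity) (by exact_mod_cast (by omega : q ≤ r + 1 - d)) d
    refine le_trans (le_of_eq ?_) (Finset.card_nsmul_le_sum _ _ _ hterm)
    rw [Nat.card_Ico, show 2 * q + d - (q + d) = q by omega, nsmul_eq_mul]
    ring
  -- Apply the bounds with `q = R / 4` rounded down: it is at least `R / 8`, and `2q + d + 2n ≤ R`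
  -- once `R` passes the threshold.
  refine ⟨1 / (8 ^ (2 * d + 1) * (d.factorial : ℝ) ^ 2 * (c * ((n : ℝ) ^ 2 + 1))), by positivity,
    4 * (d + 2 * n + 1), fun R hR => ?_⟩
  have h1 := (hlow (R / 4)).trans (hup (2 * (R / 4) + d))
  have h2 : F (2 * (R / 4) + d + 2 * n) ≤ F R := hFmono (by omega)
  have h3 : (R : ℝ) / 8 ≤ ((R / 4 : ℕ) : ℝ) := by
    rw [div_le_iff₀ (by norm_num)]
    exact_mod_cast (by omega : R ≤ R / 4 * 8)
  have h4 : ((R : ℝ) / 8) ^ (2 * d + 1) ≤ ((R / 4 : ℕ) : ℝ) ^ (2 * d + 1) :=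
    pow_le_pow_left₀ (by positivity) h3 _
  have h5 : ((R : ℝ) / 8) ^ (2 * d + 1) / (d.factorial : ℝ) ^ 2 ≤ c * ((n : ℝ) ^ 2 + 1) * F R :=
    (div_le_div_of_nonneg_right h4 (by positivity)).trans
      (h1.trans (mul_le_mul_of_nonneg_left h2 (by positivity)))
  rw [one_div_mul_eq_div, div_le_iff₀ (by positivity)]
  rw [div_pow, div_div, div_le_iff₀ (by positivity)] at h5
  linarith

end Growth

/-! ### Normal equations -/

section LeastSquares

variable {m p : ℕ}

/-- The normal equations of least squares. -/
lemma IsOLS.normal_equation {T N₁ N : ℕ} {u : ℕ → Fin p → ℝ} {y : ℕ → Fin m → ℝ}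
    {G : Matrix (Fin m) (Fin T × Fin p) ℝ} (hG : IsOLS T N₁ N u y G) (i : Fin m)
    (q : Fin T × Fin p) :
    ∑ t ∈ Finset.Icc N₁ N, (G *ᵥ concatInput T u t - y t) i * concatInput T u t q = 0 := by
  -- Perturbing a single entry makes the loss quadratic in `ε`. Minimality at `ε = 0` forces the
  -- linear coefficient to vanish, through the discriminant.
  have hexp : ∀ ε : ℝ, squaredLoss T N₁ N u y (G + Matrix.single i q ε)
      = squaredLoss T N₁ N u y G
        + 2 * ε * ∑ t ∈ Finset.Icc N₁ N, (G *ᵥ concatInput T u t - y t) i * concatInput T u t q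
        + ε ^ 2 * ∑ t ∈ Finset.Icc N₁ N, concatInput T u t q ^ 2 := by
    intro ε
    simp only [squaredLoss]
    rw [Finset.mul_sum, Finset.mul_sum, ← Finset.sum_add_distrib, ← Finset.sum_add_distrib]
    refine Finset.sum_congr rfl fun t _ => ?_
    have e : WithLp.toLp 2 ((G + Matrix.single i q ε) *ᵥ concatInput T u t - y t)
        = WithLp.toLp 2 (G *ᵥ concatInput T u t - y t)
          + EuclideanSpace.single i (ε * concatInput T u t q) := by
      ext k
      simp only [Matrix.add_mulVec, Matrix.single_mulVec, PiLp.add_apply, PiLp.single_apply,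
        Pi.add_apply, Pi.sub_apply, Function.update_apply, Pi.zero_apply]
      ring
    rw [e, norm_add_sq_real, EuclideanSpace.inner_single_right, PiLp.norm_single, Real.norm_eq_abs,
      sq_abs]
    simp only [conj_trivial]
    ring
  set b := ∑ t ∈ Finset.Icc N₁ N, (G *ᵥ concatInput T u t - y t) i * concatInput T u t q
  set c := ∑ t ∈ Finset.Icc N₁ N, concatInput T u t q ^ 2
  have key : ∀ ε : ℝ, 0 ≤ c * (ε * ε) + (2 * b) * ε + 0 := by
    intro ε
    have := hG (G + Matrix.single i q ε)
    rw [hexp] at this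
    nlinarith
  have hd := discrim_le_zero key
  rw [discrim] at hd
  nlinarith [sq_nonneg b]

/-- The estimation error, tested against the inputs, is the correlation of the residual of `G₀`
with the input. -/
lemma IsOLS.error_equation {T N₁ N : ℕ} {u : ℕ → Fin p → ℝ} {y : ℕ → Fin m → ℝ}
    {G : Matrix (Fin m) (Fin T × Fin p) ℝ} (hG : IsOLS T N₁ N u y G)
    (G₀ : Matrix (Fin m) (Fin T × Fin p) ℝ) (i : Fin m) (q : Fin T × Fin p) :
    ∑ t ∈ Finset.Icc N₁ N, (y t - G₀ *ᵥ concatInput T u t) i * concatInput T u t q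
      = ((G - G₀) *ᵥ fun q' => ∑ t ∈ Finset.Icc N₁ N, concatInput T u t q' * concatInput T u t q)
        i := by
  have h := hG.normal_equation i q
  have e : ((G - G₀) *ᵥ fun q' => ∑ t ∈ Finset.Icc N₁ N,
      concatInput T u t q' * concatInput T u t q) i
      = ∑ t ∈ Finset.Icc N₁ N, ((G - G₀) *ᵥ concatInput T u t) i * concatInput T u t q := by
    simp only [Matrix.mulVec, dotProduct, Finset.mul_sum, Finset.sum_mul]
    rw [Finset.sum_comm]
    exact Finset.sum_congr rfl fun _ _ => Finset.sum_congr rfl fun _ _ => by ring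
  rw [e, ← sub_eq_zero, ← Finset.sum_sub_distrib, ← neg_eq_zero, ← Finset.sum_neg_distrib, ← h]
  refine Finset.sum_congr rfl fun t _ => ?_
  simp only [Matrix.sub_mulVec, Pi.sub_apply]
  ring

/-- A lower bound for the operator norm from a single test vector and a single coordinate. -/
lemma sq_mulVec_apply_le {ι : Type*} [Fintype ι] [DecidableEq ι] (M : Matrix (Fin m) ι ℝ)
    (s : ι → ℝ) (i : Fin m) :
    ((M *ᵥ s) i) ^ 2 ≤ ‖M‖ ^ 2 * ∑ q, s q ^ 2 := by
  have h1 := Matrix.l2_opNorm_mulVec M (WithLp.toLp 2 s)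
  have h2 := pow_le_pow_left₀ (norm_nonneg _) h1 2
  rw [mul_pow, EuclideanSpace.real_norm_sq_eq, EuclideanSpace.real_norm_sq_eq] at h2
  refine le_trans ?_ h2
  exact Finset.single_le_sum (f := fun k => ((M *ᵥ s) k) ^ 2) (fun k _ => sq_nonneg _)
    (Finset.mem_univ i)

end LeastSquares

/-! ### Closed form of the state and of the truncation residual -/

section Trajectory

variable {n m p dw dz : ℕ} {A : Matrix (Fin n) (Fin n) ℝ}
  {B : Matrix (Fin n) (Fin p) ℝ} {C : Matrix (Fin m) (Fin n) ℝ} {D : Matrix (Fin m) (Fin p) ℝ}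
  {Bw : Matrix (Fin n) (Fin dw) ℝ} {Dz : Matrix (Fin m) (Fin dz) ℝ} {xinit : Fin n → ℝ}
  {u : ℕ → Fin p → ℝ} {x : ℕ → Fin n → ℝ} {y : ℕ → Fin m → ℝ}

lemma IsTrajectory.state_eq
    (h : IsTrajectory A B C D Bw Dz xinit u (fun _ => 0) (fun _ => 0) x y) (τ : ℕ) :
    x (τ + 1) = A ^ τ *ᵥ xinit
      + ∑ r ∈ Finset.range τ, (A ^ (τ - 1 - r) * B) *ᵥ u (r + 1) := by
  induction τ with
  | zero => simp [h.init]
  | succ τ ih =>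
    rw [h.state (τ + 1) (by omega), ih, Finset.sum_range_succ, Matrix.mulVec_add,
      Matrix.mulVec_mulVec, ← pow_succ', Matrix.mulVec_zero, add_zero, add_assoc]
    congr 2
    · rw [Matrix.mulVec_sum]
      refine Finset.sum_congr rfl fun r hr => ?_
      rw [Finset.mem_range] at hr
      rw [Matrix.mulVec_mulVec, ← Matrix.mul_assoc, ← pow_succ',
        show τ - 1 - r + 1 = τ + 1 - 1 - r by omega]
    · simp

lemma response_mulVec (T' : ℕ) (v : Fin (T' + 1) × Fin p → ℝ) :
    response A B C D (T' + 1) *ᵥ v = D *ᵥ (fun l => v (0, l))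
      + ∑ j : Fin T', (C * A ^ (j : ℕ) * B) *ᵥ fun l => v (j.succ, l) := by
  ext i
  simp only [Matrix.mulVec, dotProduct, Fintype.sum_prod_type, Fin.sum_univ_succ, response,
    Matrix.of_apply, Pi.add_apply, Finset.sum_apply]
  simp

/-- The truncation residual `y_t - G⋆ ū_t` in terms of the inputs outside the window. -/
lemma IsTrajectory.residual_eq
    (h : IsTrajectory A B C D Bw Dz xinit u (fun _ => 0) (fun _ => 0) x y) {T τ : ℕ}
    (hT : 1 ≤ T) (hτ : T ≤ τ + 1) (i : Fin m) :
    (y (τ + 1) - response A B C D T *ᵥ concatInput T u (τ + 1)) i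
      = ((C * A ^ τ) *ᵥ xinit) i + ∑ q ∈ Finset.range (τ + 1 - T) ×ˢ Finset.univ,
        (C * A ^ (τ - 1 - q.1) * B) i q.2 * u (q.1 + 1) q.2 := by
  obtain ⟨T', rfl⟩ : ∃ T', T = T' + 1 := ⟨T - 1, by omega⟩
  obtain ⟨d, rfl⟩ : ∃ d, τ = d + T' := ⟨τ - T', by omega⟩
  have hy : y (d + T' + 1) = (C * A ^ (d + T')) *ᵥ xinit
      + ∑ r ∈ Finset.range (d + T'), (C * A ^ (d + T' - 1 - r) * B) *ᵥ u (r + 1)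
      + D *ᵥ u (d + T' + 1) := by
    rw [h.output _ (by omega), h.state_eq, Matrix.mulVec_zero, add_zero, Matrix.mulVec_add,
      Matrix.mulVec_mulVec, Matrix.mulVec_sum]
    simp only [Matrix.mulVec_mulVec, Matrix.mul_assoc]
  have hresp : response A B C D (T' + 1) *ᵥ concatInput (T' + 1) u (d + T' + 1)
      = D *ᵥ u (d + T' + 1)
        + ∑ r ∈ Finset.range T', (C * A ^ (T' - 1 - r) * B) *ᵥ u (d + r + 1) := by
    rw [response_mulVec]
    congr 1
    rw [← Finset.sum_range_reflect, Finset.sum_range]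
    refine Finset.sum_congr rfl fun j _ => ?_
    have hj := j.2
    rw [show T' - 1 - (T' - 1 - (j : ℕ)) = j by omega]
    congr 1
    ext l
    simp only [concatInput, Fin.val_succ]
    rw [show d + T' + 1 - ((j : ℕ) + 1) = d + (T' - 1 - j) + 1 by omega]
  -- The second sum collects the inputs inside the window and cancels against the response; the
  -- first, over times up to `d`, is what truncation misses.
  have hsplit : ∑ r ∈ Finset.range (d + T'), (C * A ^ (d + T' - 1 - r) * B) *ᵥ u (r + 1)
      = ∑ r ∈ Finset.range d, (C * A ^ (d + T' - 1 - r) * B) *ᵥ u (r + 1)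
        + ∑ r ∈ Finset.range T', (C * A ^ (T' - 1 - r) * B) *ᵥ u (d + r + 1) := by
    rw [Finset.sum_range_add]
    congr 1
    refine Finset.sum_congr rfl fun r _ => ?_
    rw [show d + T' - 1 - (d + r) = T' - 1 - r by omega]
  rw [hy, hresp, hsplit, show d + T' + 1 - (T' + 1) = d by omega, Finset.sum_product]
  simp only [Pi.add_apply, Pi.sub_apply, Finset.sum_apply, Matrix.mulVec, dotProduct]
  ring

end Trajectory

/-! ### Gram column and input correlation for Gaussian inputs -/

section Inputs

variable {Ω : Type*} [MeasurableSpace Ω] {μ : Measure Ω} [IsProbabilityMeasure μ] {p : ℕ}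

/-- Up to a null set, the coordinates of Gaussian inputs are a standard Gaussian family. -/
lemma IsGaussianInput.exists_family {u : ℕ → Ω → Fin p → ℝ} (hu : IsGaussianInput μ u) :
    ∃ W : ℕ × Fin p → Ω → ℝ, IsStdGaussianFamily μ W ∧
      ∀ᵐ ω ∂μ, ∀ r l, u (r + 1) ω l = W (r, l) ω := by
  have hlaw : ∀ r : ℕ, HasLaw (u (r + 1)) (Measure.pi fun _ : Fin p => gaussianReal 0 1) μ :=
    fun r => hu.law (r + 1) (by omega)
  have hae : ∀ r, AEMeasurable (u (r + 1)) μ := fun r => (hlaw r).aemeasurable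
  -- The inputs are only almost everywhere measurable, whereas the `FreeOf` argument needs genuinely
  -- measurable variables.
  set v : ℕ → Ω → Fin p → ℝ := fun r => (hae r).mk with hv
  have hvm : ∀ r, Measurable (v r) := fun r => (hae r).measurable_mk
  have hvu : ∀ r, u (r + 1) =ᵐ[μ] v r := fun r => (hae r).ae_eq_mk
  have hvlaw : ∀ r, HasLaw (v r) (Measure.pi fun _ : Fin p => gaussianReal 0 1) μ :=
    fun r => (hlaw r).congr (hvu r).symm
  have hvind : iIndepFun v μ := hu.indep.congr hvu
  have hcoord : ∀ r l, HasLaw (fun ω => v r ω l) (gaussianReal 0 1) μ := fun r l =>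
    (measurePreserving_eval (fun _ : Fin p => gaussianReal 0 1) l).fun_comp_hasLaw (hvlaw r)
  refine ⟨fun q ω => v q.1 ω q.2, ⟨fun q => ?_, ?_, fun q => hcoord q.1 q.2⟩, ?_⟩
  · exact (measurable_pi_apply q.2).comp (hvm q.1)
  · refine iIndepFun_uncurry' (X := fun r l ω => v r ω l)
      (fun r l => (measurable_pi_apply l).comp (hvm r)) hvind fun r => ?_
    have hml : ∀ l, AEMeasurable (fun ω => v r ω l) μ := fun l => (hcoord r l).aemeasurable
    rw [iIndepFun_iff_map_fun_eq_pi_map hml]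
    simp_rw [fun l => (hcoord r l).map_eq]
    exact (hvlaw r).map_eq
  · rw [ae_all_iff]
    intro r
    filter_upwards [hvu r] with ω hω l
    rw [hω]

variable {W : ℕ × Fin p → Ω → ℝ}

/-- The second moment of a column of the empirical Gram matrix of the inputs. -/
lemma IsStdGaussianFamily.integral_gram_column_le (hW : IsStdGaussianFamily μ W) {T a N : ℕ}
    (hT : T ≤ a + 1) (ha : a ≤ N) (hN : T * p ≤ N) (l₀ : Fin p) :
    ∫ ω, ∑ q : Fin T × Fin p, (∑ τ ∈ Finset.Ico a N, W (τ - q.1, q.2) ω * W (τ, l₀) ω) ^ 2 ∂μ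
      ≤ (gaussianFourth + 1) * (N : ℝ) ^ 2 := by
  have hM := gaussianFourth_nonneg
  have hinj : Function.Injective fun τ : ℕ => (τ, l₀) := fun _ _ h => (Prod.mk.inj h).1
  have hNa : ((N - a : ℕ) : ℝ) ≤ N := by exact_mod_cast Nat.sub_le _ _
  have hone : ∀ i, ∫ ω, W i ω ^ 2 ∂μ = 1 := fun i => by
    rw [integral_pow_of_hasLaw_gaussian (hW.law i), integral_sq_gaussianReal]
  have hm : ∀ q : Fin T × Fin p, HasMoments μ
      (fun ω => (∑ τ ∈ Finset.Ico a N, W (τ - q.1, q.2) ω * W (τ, l₀) ω) ^ 2) := fun q =>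
    (HasMoments.sum _ fun τ _ => (hW.hasMoments _).mul (hW.hasMoments _)).pow 2
  -- Off the diagonal the sum is again a martingale transform, of size `√N` only. The hypothesis `T
  -- ≤ a + 1` keeps the subtraction `τ - q.1` from truncating.
  have hoff : ∀ q : Fin T × Fin p, ¬ ((q.1 : ℕ) = 0 ∧ q.2 = l₀) →
      ∫ ω, (∑ τ ∈ Finset.Ico a N, W (τ - q.1, q.2) ω * W (τ, l₀) ω) ^ 2 ∂μ ≤ N := by
    intro q hq
    have hqT := q.1.2
    have h := (hW.transform_moments (fun τ => (τ, l₀)) (fun τ => W (τ - q.1, q.2)) a hinj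
      (fun t ht s hs hst => freeOf_coord fun e => hq ?_) (fun t => hW.hasMoments _) N ha).1
    · rw [h]
      simp_rw [hone]
      simp [hNa]
    · obtain ⟨e1, e2⟩ := Prod.mk.inj e
      exact ⟨by omega, e2⟩
  have hdiag : ∀ q : Fin T × Fin p, ((q.1 : ℕ) = 0 ∧ q.2 = l₀) →
      ∫ ω, (∑ τ ∈ Finset.Ico a N, W (τ - q.1, q.2) ω * W (τ, l₀) ω) ^ 2 ∂μ
        ≤ gaussianFourth * (N : ℝ) ^ 2 := by
    rintro q ⟨hq1, hq2⟩
    have hle : ∀ ω, (∑ τ ∈ Finset.Ico a N, W (τ - q.1, q.2) ω * W (τ, l₀) ω) ^ 2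
        ≤ (N : ℝ) * ∑ τ ∈ Finset.Ico a N, W (τ, l₀) ω ^ 4 := by
      intro ω
      refine (sq_sum_le_card_mul_sum_sq).trans ?_
      rw [Nat.card_Ico]
      refine mul_le_mul hNa (le_of_eq ?_) (Finset.sum_nonneg fun _ _ => sq_nonneg _)
        (Nat.cast_nonneg N)
      refine Finset.sum_congr rfl fun τ _ => ?_
      rw [hq1, hq2, Nat.sub_zero]
      ring
    have hm4 : ∀ τ, HasMoments μ fun ω => W (τ, l₀) ω ^ 4 := fun τ => (hW.hasMoments _).pow 4
    refine (integral_mono (hm q).integrable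
      ((HasMoments.sum _ fun τ _ => hm4 τ).const_mul (N : ℝ)).integrable hle).trans ?_
    rw [integral_const_mul, integral_finsetSum _ fun τ _ => (hm4 τ).integrable]
    simp_rw [fun τ => integral_pow_of_hasLaw_gaussian (hW.law (τ, l₀)) 4]
    rw [Finset.sum_const, Nat.card_Ico, nsmul_eq_mul]
    change (N : ℝ) * (((N - a : ℕ) : ℝ) * gaussianFourth) ≤ _
    have := mul_le_mul_of_nonneg_right hNa hM
    nlinarith [Nat.cast_nonneg (α := ℝ) N]
  rw [integral_finsetSum _ fun q _ => (hm q).integrable]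
  have hbound : ∀ q : Fin T × Fin p,
      ∫ ω, (∑ τ ∈ Finset.Ico a N, W (τ - q.1, q.2) ω * W (τ, l₀) ω) ^ 2 ∂μ
        ≤ N + if (q.1 : ℕ) = 0 ∧ q.2 = l₀ then gaussianFourth * (N : ℝ) ^ 2 else 0 := by
    intro q
    split_ifs with h
    · exact (hdiag q h).trans (le_add_of_nonneg_left (Nat.cast_nonneg N))
    · simpa using hoff q h
  refine (Finset.sum_le_sum fun q _ => hbound q).trans ?_
  rw [Finset.sum_add_distrib, Finset.sum_const, Finset.card_univ, Fintype.card_prod,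
    Fintype.card_fin, Fintype.card_fin, nsmul_eq_mul]
  -- Since `T p ≤ N`, all off-diagonal entries together cost at most `N²`, so the constant depends
  -- on neither `T` nor `p`.
  have h1 : ((T * p : ℕ) : ℝ) * N ≤ (N : ℝ) ^ 2 := by
    rw [sq]
    exact mul_le_mul_of_nonneg_right (by exact_mod_cast hN) (Nat.cast_nonneg N)
  have h2 : ∑ q : Fin T × Fin p,
      (if (q.1 : ℕ) = 0 ∧ q.2 = l₀ then gaussianFourth * (N : ℝ) ^ 2 else 0)
        ≤ gaussianFourth * (N : ℝ) ^ 2 := by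
    rw [← Finset.sum_filter, Finset.sum_const, nsmul_eq_mul]
    refine mul_le_of_le_one_left (by positivity) ?_
    exact_mod_cast Finset.card_le_one.2 fun q hq q' hq' => by
      simp only [Finset.mem_filter, Finset.mem_univ, true_and] at hq hq'
      exact Prod.ext (Fin.ext (hq.1.trans hq'.1.symm)) (hq.2.trans hq'.2.symm)
  linarith

/-- Second moment, fourth moment and measurability of the correlation of an affine process of
strictly past inputs with the current input. -/
lemma IsStdGaussianFamily.correlation_moments (hW : IsStdGaussianFamily μ W) (b : ℕ → ℝ)
    (h : ℕ → ℕ × Fin p → ℝ) (S : ℕ → Finset (ℕ × Fin p)) (hS : ∀ τ, ∀ q ∈ S τ, q.1 < τ)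
    {a N : ℕ} (ha : a ≤ N) (l₀ : Fin p) :
    let Z : Ω → ℝ := fun ω =>
      ∑ τ ∈ Finset.Ico a N, (b τ + ∑ q ∈ S τ, h τ q * W q ω) * W (τ, l₀) ω
    Measurable Z ∧ HasMoments μ Z ∧
      ∑ τ ∈ Finset.Ico a N, ∑ q ∈ S τ, h τ q ^ 2 ≤ ∫ ω, Z ω ^ 2 ∂μ ∧
      ∫ ω, Z ω ^ 4 ∂μ ≤ 9 * (gaussianFourth + 3) ^ 2 * (∫ ω, Z ω ^ 2 ∂μ) ^ 2 := by
  intro Z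
  have hξ : ∀ τ, HasMoments μ (fun ω => b τ + ∑ q ∈ S τ, h τ q * W q ω) := fun τ =>
    (hasMoments_const _).add (HasMoments.sum _ fun q _ => (hW.hasMoments q).const_mul _)
  have hmom := hW.transform_moments (fun τ => (τ, l₀))
    (fun τ ω => b τ + ∑ q ∈ S τ, h τ q * W q ω) a (fun _ _ h => (Prod.mk.inj h).1)
    (fun t _ s _ hst => (freeOf_const _).add (FreeOf.sum _ fun q hq => (freeOf_const _).mul
      (freeOf_coord fun e => absurd hst (not_le.2 (by simpa [e] using hS s q hq)))))
    hξ N ha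
  have hmeas := hW.meas
  refine ⟨by fun_prop, HasMoments.sum _ fun τ _ => (hξ τ).mul (hW.hasMoments _), ?_, ?_⟩
  · rw [hmom.1]
    refine Finset.sum_le_sum fun τ _ => ?_
    rw [(hW.affine_moments _ _ _).1]
    exact le_add_of_nonneg_left (sq_nonneg _)
  · rw [hmom.1]
    refine hmom.2 fun τ => ?_
    rw [(hW.affine_moments _ _ _).1]
    exact (hW.affine_moments _ _ _).2

end Inputs

/-! ### Residual energy and the probabilistic lower bound -/

section LowerBound

/-- The total energy of the truncation residual is of order `N ^ (2 d + 2)`. -/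
lemma exists_residual_energy_ge {n m p : ℕ} {A : Matrix (Fin n) (Fin n) ℝ}
    {B : Matrix (Fin n) (Fin p) ℝ} {C : Matrix (Fin m) (Fin n) ℝ} (hmin : IsMinimal A B C)
    {d : ℕ} (hg : HasGrowthWitness A d) :
    ∃ c : ℝ, 0 < c ∧ ∀ T : ℕ, 1 ≤ T → ∃ N₀ : ℕ, ∀ N a : ℕ, N₀ ≤ N → T ≤ a + 1 → 10 * a ≤ N →
      c * (N : ℝ) ^ (2 * d + 2) ≤ ∑ τ ∈ Finset.Ico a N, ∑ r ∈ Finset.range (τ + 1 - T),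
        markovSq A B C (τ - 1 - r) := by
  obtain ⟨c, hc, R₀, hR⟩ := exists_sum_markovSq_ge hmin hg
  refine ⟨c / 2 / 3 ^ (2 * d + 2), by positivity, fun T hT => ?_⟩
  set F : ℕ → ℝ := fun R => ∑ r ∈ Finset.range R, markovSq A B C r with hF
  -- The first bound makes the growth estimate available for all `τ ≥ N / 2`. The second lets half
  -- of the energy absorb `F (T - 1)`, the part explained by the window, so `T` enters `N₀` but not
  -- `c`.
  refine ⟨max (2 * R₀ + 3) ⌈6 * F (T - 1) / c⌉₊, fun N a hN hTa ha => ?_⟩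
  have hN1 : 2 * R₀ + 3 ≤ N := (le_max_left _ _).trans hN
  have hN2 : 6 * F (T - 1) / c ≤ N := (Nat.le_ceil _).trans (by
    exact_mod_cast (le_max_right _ _).trans hN)
  have hinner : ∀ τ, T ≤ τ + 1 → ∑ r ∈ Finset.range (τ + 1 - T), markovSq A B C (τ - 1 - r)
      = F τ - F (T - 1) := by
    intro τ hτ
    obtain ⟨e, rfl⟩ : ∃ e, τ = T - 1 + e := ⟨τ + 1 - T, by omega⟩
    simp only [hF]
    rw [Finset.sum_range_add, add_sub_cancel_left, show T - 1 + e + 1 - T = e by omega,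
      ← Finset.sum_range_reflect]
    refine Finset.sum_congr rfl fun r hr => ?_
    rw [Finset.mem_range] at hr
    congr 1
    omega
  have hN3 : (1 : ℝ) ≤ (N : ℝ) / 3 := by
    rw [le_div_iff₀ (by norm_num)]
    exact_mod_cast (by omega : 1 * 3 ≤ N)
  have hterm : ∀ τ ∈ Finset.Ico (N / 2) N, c / 2 * ((N : ℝ) / 3) ^ (2 * d + 1)
      ≤ ∑ r ∈ Finset.range (τ + 1 - T), markovSq A B C (τ - 1 - r) := by
    intro τ hτ
    rw [Finset.mem_Ico] at hτ
    rw [hinner τ (by omega)]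
    have h1 := hR τ (by omega)
    have h2 : ((N : ℝ) / 3) ^ (2 * d + 1) ≤ (τ : ℝ) ^ (2 * d + 1) := by
      refine pow_le_pow_left₀ (by positivity) ?_ _
      rw [div_le_iff₀ (by norm_num)]
      exact_mod_cast (by omega : N ≤ τ * 3)
    have h3 : (N : ℝ) / 3 ≤ ((N : ℝ) / 3) ^ (2 * d + 1) := le_self_pow₀ hN3 (by omega)
    have h4 : F (T - 1) ≤ c / 2 * ((N : ℝ) / 3) := by
      rw [div_le_iff₀ hc] at hN2
      linarith
    have h5 := mul_le_mul_of_nonneg_left h2 hc.le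
    have h6 := mul_le_mul_of_nonneg_left h3 (half_pos hc).le
    change c * _ ≤ F τ at h1
    linarith
  have hsub : Finset.Ico (N / 2) N ⊆ Finset.Ico a N := Finset.Ico_subset_Ico_left (by omega)
  refine le_trans ?_ (Finset.sum_le_sum_of_subset_of_nonneg hsub fun _ _ _ =>
    Finset.sum_nonneg fun _ _ => markovSq_nonneg _)
  refine le_trans ?_ (Finset.card_nsmul_le_sum _ _ _ hterm)
  have hcard : (N : ℝ) / 3 ≤ ((N - N / 2 : ℕ) : ℝ) := by
    rw [div_le_iff₀ (by norm_num)]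
    exact_mod_cast (by omega : N ≤ (N - N / 2) * 3)
  rw [Nat.card_Ico, nsmul_eq_mul]
  calc c / 2 / 3 ^ (2 * d + 2) * (N : ℝ) ^ (2 * d + 2)
      = ((N : ℝ) / 3) * (c / 2 * ((N : ℝ) / 3) ^ (2 * d + 1)) := by
        rw [div_pow, show 2 * d + 2 = 2 * d + 1 + 1 from rfl, pow_succ (N : ℝ), pow_succ (3 : ℝ)]
        field_simp
    _ ≤ _ := mul_le_mul_of_nonneg_right hcard (by positivity)

/-- The universal constant in the fourth-moment comparison. -/
noncomputable def momentRatio : ℝ := 9 * (gaussianFourth + 3) ^ 2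

lemma momentRatio_pos : 0 < momentRatio := by
  have := gaussianFourth_nonneg
  unfold momentRatio
  positivity

/-- With probability bounded below by a universal constant, the error of every least squares
estimate is at least of order `N ^ d` when `A ^ r` grows at least like `r.choose d`. -/
theorem exists_error_lower_bound {n m p : ℕ} (A : Matrix (Fin n) (Fin n) ℝ)
    (B : Matrix (Fin n) (Fin p) ℝ) (C : Matrix (Fin m) (Fin n) ℝ) (hmin : IsMinimal A B C)
    {d : ℕ} (hg : HasGrowthWitness A d) :
    ∃ K : ℝ, 0 < K ∧
      ∀ (D : Matrix (Fin m) (Fin p) ℝ) (dw dz : ℕ) (Bw : Matrix (Fin n) (Fin dw) ℝ)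
        (Dz : Matrix (Fin m) (Fin dz) ℝ) (xinit : Fin n → ℝ) (T : ℕ), 1 ≤ T →
        ∃ N₀ : ℕ, ∀ N : ℕ, N₀ ≤ N → ∀ N₁ : ℕ, T ≤ N₁ → 10 * N₁ ≤ N →
          ∀ (Ω : Type*) [MeasurableSpace Ω] (μ : Measure Ω) [IsProbabilityMeasure μ]
            (u : ℕ → Ω → Fin p → ℝ) (x : ℕ → Ω → Fin n → ℝ) (y : ℕ → Ω → Fin m → ℝ)
            (Ghat : Ω → Matrix (Fin m) (Fin T × Fin p) ℝ),
            IsGaussianInput μ u →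
            (∀ ω, IsTrajectory A B C D Bw Dz xinit (fun t => u t ω)
              (fun _ => 0) (fun _ => 0) (fun t => x t ω) (fun t => y t ω)) →
            (∀ᵐ ω ∂μ, IsOLS T N₁ N (fun t => u t ω) (fun t => y t ω) (Ghat ω)) →
            1 / (8 * momentRatio) ≤ μ.real {ω | K * (N : ℝ) ^ d ≤
              ‖Ghat ω - response A B C D T‖} := by
  obtain ⟨c, hc, hen⟩ := exists_residual_energy_ge hmin hg
  have hM := gaussianFourth_nonneg
  have hκ := momentRatio_pos
  -- Chosen so that Markov's inequality for the Gram column fails with probability at most `1 / (8 *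
  -- momentRatio)`, half of what Paley–Zygmund provides.
  set R : ℝ := 8 * momentRatio * (gaussianFourth + 1) with hR
  have hRpos : 0 < R := by positivity
  have hK : 0 < c / (2 * (m + 1) * R) := by positivity
  -- The 2 is the Paley–Zygmund level, `m + 1` the choice of one output coordinate, `R` the Gram
  -- column.
  refine ⟨√(c / (2 * (m + 1) * R)), Real.sqrt_pos.2 hK, fun D dw dz Bw Dz xinit T hT => ?_⟩
  obtain ⟨N₀, hN₀⟩ := hen T hT
  refine ⟨max (N₀ + 1) (T * p), fun N hN N₁ hTN₁ hN₁ Ω _ μ _ u x y Ghat hu htraj hols => ?_⟩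
  -- Times are shifted by one: the input at time `τ + 1` is `W (τ, ·)`.
  obtain ⟨a, rfl⟩ : ∃ a, N₁ = a + 1 := ⟨N₁ - 1, by omega⟩
  have hNN₀ : N₀ + 1 ≤ N := (le_max_left _ _).trans hN
  have hNT : T * p ≤ N := (le_max_right _ _).trans hN
  have hNpos : (0 : ℝ) < N := by exact_mod_cast (by omega : 0 < N)
  have haN : a ≤ N := by omega
  have henergy := hN₀ N a (by omega) hTN₁ (by omega)
  obtain ⟨W, hW, hWu⟩ := hu.exists_family
  set S : ℕ → Finset (ℕ × Fin p) := fun τ => Finset.range (τ + 1 - T) ×ˢ Finset.univ with hS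
  set h : Fin m → ℕ → ℕ × Fin p → ℝ := fun i τ q => (C * A ^ (τ - 1 - q.1) * B) i q.2 with hh
  set E : Fin m → ℝ := fun i => ∑ τ ∈ Finset.Ico a N, ∑ q ∈ S τ, h i τ q ^ 2 with hE
  have hsumE : c * (N : ℝ) ^ (2 * d + 2) ≤ ∑ i, E i := by
    refine henergy.trans (le_of_eq ?_)
    simp only [hE, hS, hh, Finset.sum_product, markovSq]
    rw [Finset.sum_comm]
    refine Finset.sum_congr rfl fun τ _ => ?_
    rw [Finset.sum_comm]
  obtain ⟨i, hi⟩ : ∃ i, c * (N : ℝ) ^ (2 * d + 2) / (m + 1) ≤ E i := by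
    by_contra! hcon
    have h1 : ∑ i, E i ≤ ∑ _i : Fin m, c * (N : ℝ) ^ (2 * d + 2) / (m + 1) :=
      Finset.sum_le_sum fun i _ => (hcon i).le
    rw [Finset.sum_const, Finset.card_univ, Fintype.card_fin, nsmul_eq_mul] at h1
    have h2 := hsumE.trans h1
    rw [mul_div_assoc', le_div_iff₀ (by positivity)] at h2
    have h3 : 0 < c * (N : ℝ) ^ (2 * d + 2) := by positivity
    nlinarith
  -- Without inputs the residual energy would be zero, against its lower bound.
  obtain ⟨l₀⟩ : Nonempty (Fin p) := by
    by_contra hcon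
    rw [not_nonempty_iff] at hcon
    have h0 : E i = 0 := by simp [hE, hS]
    rw [h0] at hi
    have h3 : 0 < c * (N : ℝ) ^ (2 * d + 2) / (m + 1) := by positivity
    linarith
  set b : ℕ → ℝ := fun τ => ((C * A ^ τ) *ᵥ xinit) i with hb
  have hcorr := hW.correlation_moments b (h i) S (fun τ q hq => by
    simp only [hS, Finset.mem_product, Finset.mem_range] at hq
    omega) haN l₀
  set Z : Ω → ℝ := fun ω =>
    ∑ τ ∈ Finset.Ico a N, (b τ + ∑ q ∈ S τ, h i τ q * W q ω) * W (τ, l₀) ω with hZ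
  obtain ⟨hZm, hZmom, hZ2, hZ4⟩ := hcorr
  have hV : c * (N : ℝ) ^ (2 * d + 2) / (m + 1) ≤ ∫ ω, Z ω ^ 2 ∂μ := hi.trans hZ2
  have hVpos : 0 < ∫ ω, Z ω ^ 2 ∂μ := lt_of_lt_of_le (by positivity) hV
  have hPZ := paleyZygmund_sq hZm hZmom hκ hVpos hZ4
  set s : Fin T × Fin p → Ω → ℝ := fun q ω =>
    ∑ τ ∈ Finset.Ico a N, W (τ - q.1, q.2) ω * W (τ, l₀) ω with hs
  have hgram : ∫ ω, ∑ q, s q ω ^ 2 ∂μ ≤ (gaussianFourth + 1) * (N : ℝ) ^ 2 :=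
    hW.integral_gram_column_le hTN₁ haN hNT l₀
  have hgramInt : Integrable (fun ω => ∑ q, s q ω ^ 2) μ :=
    (HasMoments.sum _ fun q _ => (HasMoments.sum _ fun τ _ =>
      (hW.hasMoments _).mul (hW.hasMoments _)).pow 2).integrable
  have hmarkov : μ.real {ω | R * (N : ℝ) ^ 2 ≤ ∑ q, s q ω ^ 2} ≤ 1 / (8 * momentRatio) := by
    have h1 := (mul_meas_ge_le_integral_of_nonneg (ae_of_all _ fun ω =>
      Finset.sum_nonneg fun q _ => sq_nonneg (s q ω)) hgramInt (R * (N : ℝ) ^ 2)).trans hgram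
    rw [le_div_iff₀ (by positivity)]
    have h2 : 0 < (gaussianFourth + 1) * (N : ℝ) ^ 2 := by positivity
    rw [hR] at h1
    by_contra! hcon
    have := mul_lt_mul_of_pos_left hcon h2
    nlinarith
  have hsubset : ∀ᵐ ω ∂μ, ω ∈ {ω | (∫ ω, Z ω ^ 2 ∂μ) / 2 ≤ Z ω ^ 2} →
      ω ∈ {ω | √(c / (2 * (m + 1) * R)) * (N : ℝ) ^ d ≤ ‖Ghat ω - response A B C D T‖} ∪
        {ω | R * (N : ℝ) ^ 2 ≤ ∑ q, s q ω ^ 2} := by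
    filter_upwards [hWu, hols] with ω hω hG hZω
    by_cases hsω : R * (N : ℝ) ^ 2 ≤ ∑ q, s q ω ^ 2
    · exact Or.inr hsω
    refine Or.inl ?_
    push Not at hsω
    have hreindex : ∀ f : ℕ → ℝ, ∑ t ∈ Finset.Icc (a + 1) N, f t
        = ∑ τ ∈ Finset.Ico a N, f (τ + 1) := by
      intro f
      rw [Finset.sum_Ico_add' f a N 1]
      rfl
    -- Lag 0 is the tested column: the current input is independent of the residual, which makes the
    -- correlation a martingale transform.
    have herr := hG.error_equation (response A B C D T) i (⟨0, hT⟩, l₀)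
    have hZeq : ∑ t ∈ Finset.Icc (a + 1) N,
        (y t ω - response A B C D T *ᵥ concatInput T (fun t => u t ω) t) i *
          concatInput T (fun t => u t ω) t (⟨0, hT⟩, l₀) = Z ω := by
      rw [hreindex]
      refine Finset.sum_congr rfl fun τ hτ => ?_
      rw [Finset.mem_Ico] at hτ
      rw [(htraj ω).residual_eq hT (by omega) i]
      simp only [concatInput, Nat.sub_zero, hω]
      rfl
    have hseq : (fun q' => ∑ t ∈ Finset.Icc (a + 1) N, concatInput T (fun t => u t ω) t q' *
        concatInput T (fun t => u t ω) t (⟨0, hT⟩, l₀)) = fun q => s q ω := by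
      ext q
      rw [hreindex]
      refine Finset.sum_congr rfl fun τ hτ => ?_
      rw [Finset.mem_Ico] at hτ
      have hq := q.1.2
      simp only [concatInput, Nat.sub_zero]
      rw [show τ + 1 - (q.1 : ℕ) = (τ - q.1) + 1 by omega, hω, hω]
    rw [hZeq, hseq] at herr
    have hnorm := sq_mulVec_apply_le (Ghat ω - response A B C D T) (fun q => s q ω) i
    rw [← herr] at hnorm
    have h1 : c * (N : ℝ) ^ (2 * d + 2) / (m + 1) / 2
        ≤ ‖Ghat ω - response A B C D T‖ ^ 2 * (R * (N : ℝ) ^ 2) :=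
      calc _ ≤ (∫ ω, Z ω ^ 2 ∂μ) / 2 := by linarith
        _ ≤ Z ω ^ 2 := hZω
        _ ≤ _ := hnorm
        _ ≤ _ := mul_le_mul_of_nonneg_left hsω.le (sq_nonneg _)
    refine le_of_sq_le_sq ?_ (norm_nonneg _)
    rw [mul_pow, Real.sq_sqrt hK.le]
    have h2 : c / (2 * (m + 1) * R) * ((N : ℝ) ^ d) ^ 2
        = c * (N : ℝ) ^ (2 * d + 2) / (m + 1) / 2 / (R * (N : ℝ) ^ 2) := by
      rw [pow_add, pow_mul']
      field_simp
    rw [h2, div_le_iff₀ (by positivity)]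
    exact h1
  -- Monotonicity and subadditivity hold for arbitrary sets, so the estimator need not be
  -- measurable.
  have hfin := hPZ.trans <| (ENNReal.toReal_mono (measure_ne_top μ _) (measure_mono_ae hsubset)).trans
    (measureReal_union_le _ _)
  have h8 : 1 / (4 * momentRatio) = 1 / (8 * momentRatio) + 1 / (8 * momentRatio) := by
    field_simp
    norm_num
  linarith

end LowerBound

end OLSLowerBound

/-! ### The two claims -/

theorem mainTheorem7 :
    -- quantitative lower bound, with a universal probability `c`
    (∃ c : ℝ, 0 < c ∧
      ∀ (n m p k : ℕ) (A : Matrix (Fin n) (Fin n) ℝ) (B : Matrix (Fin n) (Fin p) ℝ)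
        (C : Matrix (Fin m) (Fin n) ℝ),
        OLSLowerBound.IsMinimal A B C →
        (∃ ev : ℂ, ‖ev‖ = 1 ∧ OLSLowerBound.HasJordanBlock A ev k) →
        ∃ K : ℝ, 0 < K ∧
          ∀ (D : Matrix (Fin m) (Fin p) ℝ) (dw dz : ℕ) (Bw : Matrix (Fin n) (Fin dw) ℝ)
            (Dz : Matrix (Fin m) (Fin dz) ℝ) (xinit : Fin n → ℝ) (T : ℕ), 1 ≤ T →
            ∃ N₀ : ℕ, ∀ N : ℕ, N₀ ≤ N → ∀ N₁ : ℕ, T ≤ N₁ → 10 * N₁ ≤ N →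
              ∀ (Ω : Type*) [MeasurableSpace Ω] (μ : Measure Ω) [IsProbabilityMeasure μ]
                (u : ℕ → Ω → Fin p → ℝ) (x : ℕ → Ω → Fin n → ℝ) (y : ℕ → Ω → Fin m → ℝ)
                (Ghat : Ω → Matrix (Fin m) (Fin T × Fin p) ℝ),
                OLSLowerBound.IsGaussianInput μ u →
                (∀ ω, OLSLowerBound.IsTrajectory A B C D Bw Dz xinit (fun t => u t ω)
                  (fun _ => 0) (fun _ => 0) (fun t => x t ω) (fun t => y t ω)) →
                (∀ᵐ ω ∂μ, OLSLowerBound.IsOLS T N₁ N (fun t => u t ω) (fun t => y t ω) (Ghat ω)) →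
                c ≤ μ.real {ω | K * (N : ℝ) ^ (k - 1) ≤
                  ‖Ghat ω - OLSLowerBound.response A B C D T‖}) ∧
    -- inconsistency of OLS for marginally stable systems
    (∀ (n m p : ℕ) (A : Matrix (Fin n) (Fin n) ℝ) (B : Matrix (Fin n) (Fin p) ℝ)
        (C : Matrix (Fin m) (Fin n) ℝ) (D : Matrix (Fin m) (Fin p) ℝ) (dw dz : ℕ)
        (Bw : Matrix (Fin n) (Fin dw) ℝ) (Dz : Matrix (Fin m) (Fin dz) ℝ) (xinit : Fin n → ℝ)
        (T : ℕ),
        OLSLowerBound.IsMinimal A B C →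
        spectralRadius ℂ (A.map fun a : ℝ => (a : ℂ)) = 1 →
        1 ≤ T →
        ∀ N₁ : ℕ → ℕ, (∀ᶠ N in atTop, T ≤ N₁ N ∧ 10 * N₁ N ≤ N) →
          ∀ (Ω : Type*) [MeasurableSpace Ω] (μ : Measure Ω) [IsProbabilityMeasure μ]
            (u : ℕ → Ω → Fin p → ℝ) (x : ℕ → Ω → Fin n → ℝ) (y : ℕ → Ω → Fin m → ℝ)
            (Ghat : ℕ → Ω → Matrix (Fin m) (Fin T × Fin p) ℝ),
            OLSLowerBound.IsGaussianInput μ u →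
            (∀ ω, OLSLowerBound.IsTrajectory A B C D Bw Dz xinit (fun t => u t ω)
              (fun _ => 0) (fun _ => 0) (fun t => x t ω) (fun t => y t ω)) →
            (∀ᶠ N in atTop, ∀ᵐ ω ∂μ,
              OLSLowerBound.IsOLS T (N₁ N) N (fun t => u t ω) (fun t => y t ω) (Ghat N ω)) →
            ¬ TendstoInMeasure μ Ghat atTop
              (fun _ => OLSLowerBound.response A B C D T)) := by
  refine ⟨⟨1 / (8 * OLSLowerBound.momentRatio),
    one_div_pos.2 (mul_pos (by norm_num) OLSLowerBound.momentRatio_pos), ?_⟩, ?_⟩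
  · rintro n m p k A B C hmin ⟨ev, hev, hJ⟩
    exact OLSLowerBound.exists_error_lower_bound A B C hmin (hJ.hasGrowthWitness hev).2
  · intro n m p A B C D dw dz Bw Dz xinit T hmin hρ hT N₁ hN₁ Ω _ μ _ u x y Ghat hu htraj hols hlim
    obtain ⟨K, hK, hbound⟩ := OLSLowerBound.exists_error_lower_bound A B C hmin
      (OLSLowerBound.hasGrowthWitness_zero_of_spectralRadius hρ)
    obtain ⟨N₀, hN₀⟩ := hbound D dw dz Bw Dz xinit T hT
    rw [tendstoInMeasure_iff_measureReal_norm] at hlim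
    have hpos : 0 < 1 / (8 * OLSLowerBound.momentRatio) :=
      one_div_pos.2 (mul_pos (by norm_num) OLSLowerBound.momentRatio_pos)
    -- Convergence in probability would push the chance of an error of size `K` below the universal
    -- constant, while for `d = 0` the lower bound is `K` itself.
    have hsmall := (hlim K hK).eventually (gt_mem_nhds hpos)
    obtain ⟨N, hN, hN1, hNols, hNge⟩ :=
      (hsmall.and (hN₁.and (hols.and (eventually_ge_atTop N₀)))).exists
    have := hN₀ N hNge (N₁ N) hN1.1 hN1.2 Ω μ u x y (Ghat N) hu htraj hNols
    rw [pow_zero, mul_one] at this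
    exact absurd hN (not_lt.2 this)
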